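/- Let $N\ge 2$, let $\mathcal H_1,\dots,\mathcal H_N$ be complex separable Hilbert spaces with dimensions $d_n=\dim\mathcal H_n\in\{1,2,\dots,\infty\}$, let $\rho$ be a state (a positive trace class operator with trace $1$) on $\mathcal H_1\otimes\cdots\otimes\mathcal H_N$, and let $S_1,\dots,S_N\ge 1$ be integers. For standard Borel spaces $\Lambda_1,\dots,\Lambda_N$ and a family $\mathrm M=\{\mathrm M_n^{(s)} : 1\le s\le S_n,\ 1\le n\le N\}$ of normalized positive operator-valued measures $\mathrm M_n^{(s)}$ on $\Lambda_n$ with values in the bounded operators on $\mathcal H_n$, let $P_{(s_1,\dots,s_N)}$ be the probability measure on $\Lambda_1\times\cdots\times\Lambda_N$ with $P_{(s_1,\dots,s_N)}(F_1\times\cdots\times F_N)=\mathrm{tr}[\rho\,\{\mathrm M_1^{(s_1)}(F_1)\otimes\cdots\otimes\mathrm M_N^{(s_N)}(F_N)\}]$. Let $\gamma_{\rho,\mathrm M}$ be the infimum of the total variation norms $\|\mu\|_{var}$ over all bounded real-valued (signed) measures $\mu$ on $\Lambda_1^{S_1}\times\cdots\times\Lambda_N^{S_N}$ of total mass $1$ which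 have all the $P_{(s_1,\dots,s_N)}$ as the corresponding marginals. The maximal $S_1\times\cdots\times S_N$-setting Bell violation of $\rho$ is $$\Upsilon^{(\rho)}_{S_1\times\cdots\times S_N}:=\sup_{\Lambda_1,\dots,\Lambda_N}\ \sup_{\mathrm M}\ \gamma_{\rho,\mathrm M}.$$ Put $$\xi_N=1+2^{N-1}\Big(\frac{d_1\cdots d_N}{\max_n d_n}-1\Big),\qquad \theta_N=(-1)^{N-1}+\min_{I}\ \sum_{k=0}^{N-2}(-1)^k\,2^{N-1-k}\sum_{J\subseteq I,\ |J|=N-1-k}\ \prod_{j\in J}S_j ,$$ where $I$ runs over the subsets of $\{1,\dots,N\}$ with $N-1$ elements, and where $\frac{d_1\cdots d_N}{\max_n d_n}$ means the product of all the $d_n$ except for one of the largest, if some of them are infinite. Then $$\Upsilon^{(\rho)}_{S_1\times\cdots\times S_N}\le\min\{\xi_N,\theta_N\}\le 1+2^{N-1}\Big[\min\Big\{\frac{d_1\cdots d_N}{\max_n d_n},\ \frac{S_1\cdots S_N}{\max_n S_n}\Big\}-1\Big].$$ If, in particular, $d_n=d$ and $S_n=S$ for all $n$, then $$\Upsilon^{(\rho)}_{S\times\cdots\times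 S}\le\min\big\{(2S-1)^{N-1},\ 2^{N-1}(d^{N-1}-1)+1\big\}\le 1+2^{N-1}\big[(\min\{S,d\})^{N-1}-1\big].$$ Moreover $\Upsilon^{(\rho)}_{S_1\times\cdots\times S_N}$ (and hence each of these numbers) bounds the violation of every Bell-type inequality: for all $\Lambda_n$ and $\mathrm M$ as above and all bounded measurable functions $\psi_{(s_1,\dots,s_N)}:\Lambda_1\times\cdots\times\Lambda_N\to\mathbb R$ with $\mathcal B_\Psi:=\sup\big|\sum_{s_1,\dots,s_N}\psi_{(s_1,\dots,s_N)}(\lambda_1^{(s_1)},\dots,\lambda_N^{(s_N)})\big|\neq 0$ (supremum over all $\lambda_n^{(s)}\in\Lambda_n$), $$\frac{1}{\mathcal B_\Psi}\Big|\sum_{s_1,\dots,s_N}\int\psi_{(s_1,\dots,s_N)}\,dP_{(s_1,\dots,s_N)}\Big|\le\Upsilon^{(\rho)}_{S_1\times\cdots\times S_N}.$$ -/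

import Mathlib

open scoped ENNReal

universe u w

noncomputable section

namespace BellViolation

open MeasureTheory
open scoped ComplexConjugate InnerProductSpace ComplexOrder Matrix

/-! ### The Hilbert tensor product of a finite family of Hilbert spaces -/

theorem posSemidef_gram {α E : Type*} [NormedAddCommGroup E] [InnerProductSpace ℂ E] (v : α → E) :
    (Matrix.gram ℂ v).PosSemidef := by
  refine ⟨Matrix.isHermitian_gram ℂ v, fun c => ?_⟩
  have h : (c.sum fun i xi => c.sum fun j xj => star xi * Matrix.gram ℂ v i j * xj)
      = ((‖∑ i ∈ c.support, c i • v i‖ ^ 2 : ℝ) : ℂ) := by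
    have h2 := inner_self_eq_norm_sq_to_K (𝕜 := ℂ) (∑ i ∈ c.support, c i • v i)
    push_cast
    refine Eq.trans ?_ h2
    simp only [Finsupp.sum, sum_inner, inner_sum, inner_smul_left, inner_smul_right,
      Matrix.gram_apply]
    rw [Finset.sum_comm]
    refine Finset.sum_congr rfl fun i _ => ?_
    try rw [Finset.mul_sum]
    refine Finset.sum_congr rfl fun j _ => ?_
    simp only [starRingEnd_apply]
    ring
  rw [h]
  exact Complex.zero_le_real.2 (sq_nonneg _)

section HilbertTensor

variable {ι : Type} (H : ι → Type u)
  [∀ n, NormedAddCommGroup (H n)] [∀ n, InnerProductSpace ℂ (H n)]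

/-- The inner products `∏ ⟪xₙ, yₙ⟫` of simple tensors over a set `s` of factors. -/
def tensorKernel (s : Finset ι) : Matrix (∀ n, H n) (∀ n, H n) ℂ :=
  Matrix.of fun x y => ∏ n ∈ s, ⟪x n, y n⟫_ℂ

theorem tensorKernel_insert [DecidableEq ι] {a : ι} {s : Finset ι} (ha : a ∉ s) :
    tensorKernel H (insert a s) = Matrix.gram ℂ (fun x : ∀ n, H n => x a) ⊙ tensorKernel H s := by
  ext x y
  simp [tensorKernel, Finset.prod_insert ha]

theorem tensorKernel_posSemidef (s : Finset ι) : (tensorKernel H s).PosSemidef := by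
  classical
  induction s using Finset.induction_on with
  | empty =>
    convert posSemidef_gram (fun _ : (∀ n, H n) => (1 : ℂ)) using 1
    ext x y
    simp [tensorKernel]
  | insert a s ha ih =>
    rw [tensorKernel_insert H ha]
    exact (posSemidef_gram _).hadamard ih

theorem tensorKernel_bound (X : ∀ n, H n →L[ℂ] H n) (s : Finset ι) :
    ((∏ n ∈ s, ‖X n‖ ^ 2) • tensorKernel H s
      - (tensorKernel H s).submatrix (fun (x : ∀ n, H n) n => X n (x n)) (fun (x : ∀ n, H n) n => X n (x n))).PosSemidef := by
  classical
  induction s using Finset.induction_on with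
  | empty =>
    convert (Matrix.PosSemidef.zero : (0 : Matrix (∀ n, H n) (∀ n, H n) ℂ).PosSemidef) using 1
    ext x y
    simp [tensorKernel]
  | insert a s ha ih =>
    have h1 := (Matrix.posSemidef_opNorm_smul_gram_sub_gram (fun x : ∀ n, H n => x a) (X a)).hadamard
      ((tensorKernel_posSemidef H s).submatrix (fun (x : ∀ n, H n) n => X n (x n)))
    have h2 := (((posSemidef_gram (fun x : ∀ n, H n => x a)).smul
      (sq_nonneg ‖X a‖))).hadamard ih
    refine (congrArg Matrix.PosSemidef ?_).mp (h1.add h2)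
    ext x y
    simp [tensorKernel, Finset.prod_insert ha]
    ring

variable [Fintype ι]

/-- Formal linear combinations of simple tensors `⊗ xₙ`, with the semi-inner product determined by
`⟪⊗ xₙ, ⊗ yₙ⟫ = ∏ ⟪xₙ, yₙ⟫`; modulo null vectors this is the algebraic tensor product. -/
def PreTensor : Type u := (∀ n, H n) →₀ ℂ

instance : AddCommGroup (PreTensor H) := inferInstanceAs (AddCommGroup ((∀ n, H n) →₀ ℂ))

instance : Module ℂ (PreTensor H) := inferInstanceAs (Module ℂ ((∀ n, H n) →₀ ℂ))

/-- The semi-inner product on formal combinations of simple tensors. -/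
def preInner (f g : (∀ n, H n) →₀ ℂ) : ℂ :=
  f.sum fun x z => g.sum fun y w => star z * (∏ n, ⟪x n, y n⟫_ℂ) * w

variable {H} in
theorem preInner_conj (f g : (∀ n, H n) →₀ ℂ) :
    conj (preInner H g f) = preInner H f g := by
  unfold preInner
  rw [Finsupp.sum_comm]
  simp only [map_finsuppSum]
  congr! 4
  funext y w
  simp only [← starRingEnd_apply, map_mul, map_prod, inner_conj_symm, Complex.conj_conj]
  ring

variable {H} in
theorem preInner_add_left (f g h : (∀ n, H n) →₀ ℂ) :
    preInner H (f + g) h = preInner H f h + preInner H g h := by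
  unfold preInner
  rw [Finsupp.sum_add_index'] <;> simp [← Finsupp.sum_add, add_mul]

variable {H} in
theorem preInner_smul_left (f g : (∀ n, H n) →₀ ℂ) (r : ℂ) :
    preInner H (r • f) g = conj r * preInner H f g := by
  unfold preInner
  rw [Finsupp.sum_smul_index] <;> simp [Finsupp.mul_sum, mul_assoc]

instance : PreInnerProductSpace.Core ℂ (PreTensor H) where
  inner f g := preInner H f g
  conj_inner_symm f g := preInner_conj f g
  add_left f g h := preInner_add_left f g h
  smul_left f g r := preInner_smul_left f g r
  re_inner_nonneg f := (Complex.le_def.1 ((tensorKernel_posSemidef H Finset.univ).2 f)).1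

instance : SeminormedAddCommGroup (PreTensor H) :=
  InnerProductSpace.Core.toSeminormedAddCommGroup (𝕜 := ℂ)

instance : InnerProductSpace ℂ (PreTensor H) := .ofCore _

theorem PreTensor.inner_def (f g : PreTensor H) : ⟪f, g⟫_ℂ = preInner H f g := rfl

/-- The Hilbert space tensor product `⊗ₙ Hₙ`: the Hausdorff completion of the span of the simple
tensors. -/
abbrev HilbertTensor : Type u := UniformSpace.Completion (PreTensor H)

variable {H}

/-- The simple tensor `⊗ xₙ`, before completion. -/
def preTprod (x : ∀ n, H n) : PreTensor H := Finsupp.single x (1 : ℂ)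

/-- The simple tensor `⊗ xₙ`. -/
def tprod (x : ∀ n, H n) : HilbertTensor H := (preTprod x : HilbertTensor H)

theorem inner_tprod (x y : ∀ n, H n) : ⟪tprod x, tprod y⟫_ℂ = ∏ n, ⟪x n, y n⟫_ℂ := by
  rw [tprod, tprod, UniformSpace.Completion.inner_coe, PreTensor.inner_def]
  change preInner H (Finsupp.single x 1) (Finsupp.single y 1) = _
  rw [preInner, Finsupp.sum_single_index, Finsupp.sum_single_index] <;> simp

theorem dense_span_tprod :
    Dense ((Submodule.span ℂ (Set.range (tprod (H := H)))) : Set (HilbertTensor H)) := by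
  have h : ∀ f : PreTensor H,
      (f : HilbertTensor H) ∈ Submodule.span ℂ (Set.range (tprod (H := H))) := by
    intro f
    refine Finsupp.induction_linear (motive := fun f : (∀ n, H n) →₀ ℂ =>
      ((show PreTensor H from f : PreTensor H) : HilbertTensor H)
        ∈ Submodule.span ℂ (Set.range (tprod (H := H)))) f ?_ ?_ ?_
    · exact Submodule.zero_mem _
    · intro f g hf hg
      exact (UniformSpace.Completion.coe_add (α := PreTensor H) f g) ▸ Submodule.add_mem _ hf hg
    · intro x z
      have e : (show PreTensor H from Finsupp.single x z) = z • preTprod x :=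
        (Finsupp.smul_single_one x z).symm
      rw [e, UniformSpace.Completion.coe_smul]
      exact Submodule.smul_mem _ _ (Submodule.subset_span ⟨x, rfl⟩)
  refine Dense.mono ?_ (UniformSpace.Completion.denseRange_coe (α := PreTensor H))
  rintro _ ⟨f, rfl⟩
  exact h f

theorem ext_inner_tprod {a b : HilbertTensor H}
    (h : ∀ y : ∀ n, H n, ⟪tprod y, a⟫_ℂ = ⟪tprod y, b⟫_ℂ) : a = b := by
  rw [← sub_eq_zero]
  refine dense_span_tprod.eq_zero_of_mem_orthogonal (𝕜 := ℂ) ?_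
  intro v hv
  induction hv using Submodule.span_induction with
  | mem v hv => obtain ⟨y, rfl⟩ := hv; rw [inner_sub_right, h, sub_self]
  | zero => simp
  | add v w _ _ hv hw => rw [inner_add_left, hv, hw, add_zero]
  | smul c v _ hv => rw [inner_smul_left, hv, mul_zero]

/-- Simple tensors depend multilinearly on their factors. -/
def tprodMultilinear [DecidableEq ι] : MultilinearMap ℂ H (HilbertTensor H) :=
  have e : ∀ y z : ∀ n, H n, ⟪tprod y, tprod z⟫_ℂ = (MultilinearMap.mkPiAlgebra ℂ ι ℂ).compLinearMap
      (fun n => (innerₛₗ ℂ (y n) : H n →ₗ[ℂ] ℂ)) z := fun y z => by simp [inner_tprod]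
  { toFun := tprod
    map_update_add' := fun {_} x i a b => by
      refine ext_inner_tprod fun y => ?_
      rw [inner_add_right, e, e, e]
      convert! MultilinearMap.map_update_add _ x i a b
    map_update_smul' := fun {_} x i c a => by
      refine ext_inner_tprod fun y => ?_
      rw [inner_smul_right, e, e]
      convert! MultilinearMap.map_update_smul _ x i c a }

/-- The linear map of formal combinations induced by `⊗ xₙ ↦ ⊗ Xₙ xₙ`. -/
def preTensorOp (X : ∀ n, H n →L[ℂ] H n) : PreTensor H →ₗ[ℂ] PreTensor H :=
  Finsupp.lmapDomain ℂ ℂ fun (x : ∀ n, H n) n => X n (x n)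

/-- The bounded operator `⊗ Xₙ` on `⊗ Hₙ`: the continuous extension of `⊗ xₙ ↦ ⊗ Xₙ xₙ`. -/
def tensorOp (X : ∀ n, H n →L[ℂ] H n) : HilbertTensor H →L[ℂ] HilbertTensor H :=
  LinearMap.extendOfNorm
    ((UniformSpace.Completion.toComplL (𝕜 := ℂ) (E := PreTensor H)).toLinearMap ∘ₗ preTensorOp X)
    (UniformSpace.Completion.toComplL (𝕜 := ℂ) (E := PreTensor H)).toLinearMap

theorem preInner_mapDomain (X : ∀ n, H n →L[ℂ] H n) (f : (∀ n, H n) →₀ ℂ) :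
    preInner H (f.mapDomain fun x n => X n (x n)) (f.mapDomain fun x n => X n (x n))
      = f.sum fun x z => f.sum fun y w => star z * (∏ n, ⟪X n (x n), X n (y n)⟫_ℂ) * w := by
  rw [preInner, Finsupp.sum_mapDomain_index]
  · refine Finsupp.sum_congr fun x _ => ?_
    rw [Finsupp.sum_mapDomain_index]
    · simp
    · intros; ring
  · simp
  · intros
    simp [add_mul]

theorem norm_preTensorOp_le (X : ∀ n, H n →L[ℂ] H n) (f : PreTensor H) :
    ‖preTensorOp X f‖ ≤ (∏ n, ‖X n‖) * ‖f‖ := by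
  have hM : 0 ≤ ∏ n, ‖X n‖ := Finset.prod_nonneg fun n _ => norm_nonneg _
  refine le_of_sq_le_sq ?_ (mul_nonneg hM (norm_nonneg _))
  have h := (Complex.le_def.1 ((tensorKernel_bound H X Finset.univ).2 f)).1
  have e : (Finsupp.sum f fun x z => Finsupp.sum f fun y w => star z *
      ((∏ n, ‖X n‖ ^ 2) • tensorKernel H Finset.univ - (tensorKernel H Finset.univ).submatrix
        (fun (x : ∀ n, H n) n => X n (x n)) (fun (x : ∀ n, H n) n => X n (x n))) x y * w)
      = ((∏ n, ‖X n‖ ^ 2 : ℝ) : ℂ) * ⟪f, f⟫_ℂ - ⟪preTensorOp X f, preTensorOp X f⟫_ℂ := by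
    rw [PreTensor.inner_def, PreTensor.inner_def]
    refine Eq.trans ?_ (congrArg _ (preInner_mapDomain X f).symm)
    unfold preInner
    simp only [Finsupp.sum, Finset.mul_sum, ← Finset.sum_sub_distrib]
    refine Finset.sum_congr rfl fun x _ => Finset.sum_congr rfl fun y _ => ?_
    simp [tensorKernel]
    ring
  rw [e, inner_self_eq_norm_sq_to_K, inner_self_eq_norm_sq_to_K] at h
  rw [mul_pow, ← Finset.prod_pow]
  have h' : (0 : ℝ) ≤ (∏ n, ‖X n‖ ^ 2) * ‖f‖ ^ 2 - ‖preTensorOp X f‖ ^ 2 := by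
    refine h.trans_eq ?_
    rw [Complex.sub_re, Complex.re_ofReal_mul]
    simp [← Complex.ofReal_pow]
  linarith

theorem tensorOp_tprod (X : ∀ n, H n →L[ℂ] H n) (x : ∀ n, H n) :
    tensorOp X (tprod x) = tprod fun n => X n (x n) := by
  have h := LinearMap.extendOfNorm_eq
    (f := (UniformSpace.Completion.toComplL (𝕜 := ℂ) (E := PreTensor H)).toLinearMap ∘ₗ
      preTensorOp X)
    (e := (UniformSpace.Completion.toComplL (𝕜 := ℂ) (E := PreTensor H)).toLinearMap)
    UniformSpace.Completion.denseRange_coe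
    ⟨∏ n, ‖X n‖, fun f => by simpa using norm_preTensorOp_le X f⟩ (preTprod x)
  have e : preTensorOp X (preTprod x) = preTprod fun n => X n (x n) :=
    Finsupp.mapDomain_single
  have h2 := h.trans (congrArg (fun f : PreTensor H => (f : HilbertTensor H)) e)
  exact h2

end HilbertTensor

/-! ### States, measurements and correlation scenarios -/

section States

variable {K : Type u} [NormedAddCommGroup K] [InnerProductSpace ℂ K] [CompleteSpace K]

/-- The trace `∑ᵢ ⟪bᵢ, A bᵢ⟫` of an operator along a Hilbert basis `b`. It is only used for trace
class operators `A` (a density operator times a bounded operator), for which the sum converges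
absolutely and does not depend on `b`. -/
def trace (A : K →L[ℂ] K) : ℂ :=
  ∑' i, ⟪(exists_hilbertBasis ℂ K).choose_spec.choose i,
    A ((exists_hilbertBasis ℂ K).choose_spec.choose i)⟫_ℂ

/-- A quantum state: a positive trace class operator with trace `1`. -/
def IsState (ρ : K →L[ℂ] K) : Prop :=
  ρ.IsPositive ∧ ∀ (s : Set K) (b : HilbertBasis s ℂ K), HasSum (fun i => ⟪b i, ρ (b i)⟫_ℂ) 1

end States

/-- A normalized positive operator-valued measure on `Λ` with values in the bounded operators on
`E`, countably additive in the weak operator topology. Only the values on measurable sets matter. -/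
structure POVM (Λ : Type w) [MeasurableSpace Λ] (E : Type u) [NormedAddCommGroup E]
    [InnerProductSpace ℂ E] where
  /-- The operator assigned to an event. -/
  op : Set Λ → E →L[ℂ] E
  isPositive : ∀ F, MeasurableSet F → (op F).IsPositive
  op_univ : op Set.univ = 1
  hasSum_iUnion : ∀ F : ℕ → Set Λ, (∀ i, MeasurableSet (F i)) → Pairwise (Function.onFun Disjoint F) →
    ∀ x y : E, HasSum (fun i => ⟪x, op (F i) y⟫_ℂ) ⟪x, op (⋃ i, F i) y⟫_ℂ

section Scenario

variable {N : ℕ} {H : Fin N → Type u} [∀ n, NormedAddCommGroup (H n)]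
  [∀ n, InnerProductSpace ℂ (H n)] [∀ n, CompleteSpace (H n)]
  {S : Fin N → ℕ} {Λ : Fin N → Type w} [∀ n, MeasurableSpace (Λ n)]

/-- The probability `tr[ρ {M₁^{(s₁)}(F₁) ⊗ ⋯ ⊗ M_N^{(s_N)}(F_N)}]` of the event `F₁ × ⋯ × F_N` under
the joint measurement `s = (s₁, …, s_N)` of the scenario with measurements `M n j` (site `n`,
setting `j`) performed on the state `ρ`. -/
def jointProb (ρ : HilbertTensor H →L[ℂ] HilbertTensor H) (M : ∀ n, Fin (S n) → POVM (Λ n) (H n))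
    (s : ∀ n, Fin (S n)) (F : ∀ n, Set (Λ n)) : ℂ :=
  trace (ρ ∘L tensorOp fun n => (M n (s n)).op (F n))

/-- The normalized bounded real-valued measure `μ` on `Λ₁^{S₁} × ⋯ × Λ_N^{S_N}` returns all joint
distributions of the scenario as its marginals. (A finite measure on a product space is determined
by its values on measurable rectangles.) -/
def Simulates (ρ : HilbertTensor H →L[ℂ] HilbertTensor H) (M : ∀ n, Fin (S n) → POVM (Λ n) (H n))
    (μ : SignedMeasure (∀ n, Fin (S n) → Λ n)) : Prop :=
  μ Set.univ = 1 ∧ ∀ (s : ∀ n, Fin (S n)) (F : ∀ n, Set (Λ n)), (∀ n, MeasurableSet (F n)) →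
    ((μ {ω | ∀ n, ω n (s n) ∈ F n} : ℝ) : ℂ) = jointProb ρ M s F

/-- The scenario parameter `γ`: the infimum of the total variation norms of the normalized
real-valued measures that return all joint distributions of the scenario as marginals. -/
def gammaParam (ρ : HilbertTensor H →L[ℂ] HilbertTensor H)
    (M : ∀ n, Fin (S n) → POVM (Λ n) (H n)) : ℝ≥0∞ :=
  ⨅ (μ : SignedMeasure (∀ n, Fin (S n) → Λ n)) (_ : Simulates ρ M μ), μ.totalVariation Set.univ

/-- `P` is the joint probability distribution of the joint measurement `s`. -/
def IsJointDistribution (ρ : HilbertTensor H →L[ℂ] HilbertTensor H)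
    (M : ∀ n, Fin (S n) → POVM (Λ n) (H n)) (s : ∀ n, Fin (S n)) (P : Measure (∀ n, Λ n)) : Prop :=
  IsProbabilityMeasure P ∧ ∀ F : ∀ n, Set (Λ n), (∀ n, MeasurableSet (F n)) →
    ((P.real (Set.univ.pi F) : ℝ) : ℂ) = jointProb ρ M s F

/-- The local hidden variable constant of a family `ψ` of functions: the supremum, over all
assignments of outcomes to all settings, of `|∑_s ψ_s(λ₁^{(s₁)}, …, λ_N^{(s_N)})|`. -/
def lhvBound (ψ : (∀ n, Fin (S n)) → (∀ n, Λ n) → ℝ) : ℝ :=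
  ⨆ ω : ∀ n, Fin (S n) → Λ n, |∑ s, ψ s fun n => ω n (s n)|

variable (S) in
/-- The maximal `S₁ × ⋯ × S_N`-setting Bell violation
`Υ_{S₁ × ⋯ × S_N}^{(ρ)} = sup_Λ sup_M γ` of the state `ρ`, over all outcome sets `Λ₁, …, Λ_N`
(standard Borel spaces) and all families `M` of POV measures. -/
def maxBellViolation (ρ : HilbertTensor H →L[ℂ] HilbertTensor H) : ℝ≥0∞ :=
  ⨆ (Λ : Fin N → Type w) (_ : ∀ n, MeasurableSpace (Λ n)) (_ : ∀ n, StandardBorelSpace (Λ n))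
    (M : ∀ n, Fin (S n) → POVM (Λ n) (H n)), gammaParam ρ M

variable (S) in
/-- The largest ratio `|∑_s ⟨ψ_s⟩| / B_ψ` of the quantum value of a linear combination of averages
to its local hidden variable constant `B_ψ ≠ 0`, over all standard Borel outcome sets, all families
of POV measures, and all families `ψ` of bounded measurable real functions. -/
def maxBellRatio (ρ : HilbertTensor H →L[ℂ] HilbertTensor H) : ℝ≥0∞ :=
  ⨆ (Λ : Fin N → Type w) (_ : ∀ n, MeasurableSpace (Λ n)) (_ : ∀ n, StandardBorelSpace (Λ n))
    (M : ∀ n, Fin (S n) → POVM (Λ n) (H n)) (P : (∀ n, Fin (S n)) → Measure (∀ n, Λ n))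
    (_ : ∀ s, IsJointDistribution ρ M s (P s)) (ψ : (∀ n, Fin (S n)) → (∀ n, Λ n) → ℝ)
    (_ : ∀ s, Measurable (ψ s) ∧ ∃ C, ∀ x, |ψ s x| ≤ C) (_ : lhvBound ψ ≠ 0),
    ENNReal.ofReal (|∑ s, ∫ x, ψ s x ∂(P s)| / lhvBound ψ)

end Scenario

/-! ### The numerical bounds -/

section Bounds

variable {N : ℕ}

/-- The dimension of a complex Hilbert space, as an element of `{0, 1, 2, …, ∞}`. -/
def dimension (E : Type u) [AddCommGroup E] [Module ℂ E] : ℕ∞ :=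
  Cardinal.toENat (Module.rank ℂ E)

/-- `(a₁ ⋯ a_N) / max aₙ` for positive `aₙ`, possibly infinite: the product of all factors but a
largest one, i.e. the smallest product of `N - 1` of the factors. -/
def prodDivMax (a : Fin N → ℕ∞) : ℝ≥0∞ :=
  ⨅ m, ∏ n ∈ Finset.univ.erase m, (a n : ℝ≥0∞)

theorem prodDivMax_natCast (hN : 0 < N) (a : Fin N → ℕ) (ha : ∀ n, 0 < a n) :
    prodDivMax (fun n => (a n : ℕ∞))
      = ((∏ n, a n : ℕ) : ℝ≥0∞) / ((Finset.univ.sup a : ℕ) : ℝ≥0∞) := by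
  have hne : (Finset.univ : Finset (Fin N)).Nonempty := ⟨⟨0, hN⟩, Finset.mem_univ _⟩
  have key : ∀ m, ∏ n ∈ Finset.univ.erase m, (((a n : ℕ∞) : ℝ≥0∞))
      = ((∏ n, a n : ℕ) : ℝ≥0∞) / (a m : ℝ≥0∞) := by
    intro m
    have h0 : (a m : ℝ≥0∞) ≠ 0 := by exact_mod_cast (ha m).ne'
    rw [ENNReal.eq_div_iff h0 (ENNReal.natCast_ne_top _)]
    rw [← Finset.mul_prod_erase Finset.univ a (Finset.mem_univ m)]
    push_cast
    simp
  unfold prodDivMax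
  simp_rw [key]
  obtain ⟨m, -, hm⟩ := Finset.exists_mem_eq_sup Finset.univ hne a
  refine le_antisymm ((iInf_le _ m).trans (by rw [hm])) (le_iInf fun n => ?_)
  gcongr
  exact Finset.le_sup (Finset.mem_univ n)

/-- `ξ_N = 1 + 2^{N-1} (d₁ ⋯ d_N / max dₙ - 1)`. -/
def xiBound (d : Fin N → ℕ∞) : ℝ≥0∞ := 1 + 2 ^ (N - 1) * (prodDivMax d - 1)

/-- `θ_N = (-1)^{N-1} + min_I ∑_{k=0}^{N-2} (-1)^k 2^{N-1-k} ∑_J ∏_{j ∈ J} S_j`, where `I` runs over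
the `(N-1)`-element sets of sites and `J` over the `(N-1-k)`-element subsets of `I`. -/
def thetaBound (S : Fin N → ℕ) : ℤ :=
  (-1) ^ (N - 1) + (Finset.univ.powersetCard (N - 1)).inf'
    (Finset.powersetCard_nonempty.2 (by simp)) fun I =>
      ∑ k ∈ Finset.range (N - 1), (-1) ^ k * 2 ^ (N - 1 - k) *
        ∑ J ∈ I.powersetCard (N - 1 - k), ∏ j ∈ J, (S j : ℤ)

end Bounds

end BellViolation

end

open BellViolation

noncomputable section

namespace BellViolation

open MeasureTheory
open scoped ComplexConjugate InnerProductSpace ComplexOrder Matrix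

/-! ### Tensor products of operators -/

section TensorOp

variable {ι : Type} [Fintype ι] {H : ι → Type u}
  [∀ n, NormedAddCommGroup (H n)] [∀ n, InnerProductSpace ℂ (H n)]

/-! Writing `v k = √ρ (b k)` for a Hilbert basis `b`, cyclicity of the trace turns `tr[ρ A]` into
the positive functional `∑ₖ ⟪vₖ, A vₖ⟫` (`exists_ensemble`). An upper bound on `γ` then only needs
one signed measure with the right marginals. It is produced as a finite real combination of positive
measures, whose cost (sum of |coefficient| times mass) dominates the variation norm; `IsSimulated`
does this bookkeeping. One distinguished site `m` is free of charge in both bounds, so `m` is chosen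
to make the remaining product smallest.

Dimension bound (`isSimulated_dimension`). Expand the operators at the sites `n ≠ m` in matrix
units; with `D` the product of the dimensions of these sites, there are `D²` terms, indexed by pairs
`(i, j)`. A diagonal term is a product of positive normal functionals, hence the distribution of a
product measure, of mass `r i`, with `∑ r i = 1`. An off-diagonal term is polarized at every site:
each `n ≠ m` contributes a factor `2`, and the ensemble part contributes `(r i + r j) / 2`.
Summation gives `1 + 2 ^ (N - 1) * (D - 1)`.

Settings bound (`isSimulated_settings`). If all sites but `m` have one measurement each, a genuine
hidden variable model exists (`exists_localModel`): condition on the outcomes elsewhere, and take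
the product of the conditional laws of the different settings at `m`. For general outcome spaces
this is done on finite binary words in the Cantor space, followed by a weak limit. In general, at a
site with `Sₙ` settings, activate one setting `t` at a time while the others answer a fixed point,
add these `Sₙ` models and subtract `Sₙ - 1` copies of the model where every setting answers that
point. Every setting gets its correct law, at cost `Sₙ + (Sₙ - 1) = 2 Sₙ - 1`; `θ_N` is the expanded
product of these numbers, minimized over `m`.

Bell inequalities (`bellRatio_le`). The quantum value is the integral, against any simulating signed
measure, of a function bounded by the local hidden variable constant. -/

theorem norm_tensorOp_le (X : ∀ n, H n →L[ℂ] H n) : ‖tensorOp X‖ ≤ ∏ n, ‖X n‖ :=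
  LinearMap.opNorm_extendOfNorm_le UniformSpace.Completion.denseRange_coe
    (Finset.prod_nonneg fun _ _ => norm_nonneg _) fun f => by simpa using norm_preTensorOp_le X f

theorem ext_tprod {A B : HilbertTensor H →L[ℂ] HilbertTensor H}
    (h : ∀ x, A (tprod x) = B (tprod x)) : A = B := by
  refine ContinuousLinearMap.ext_on dense_span_tprod ?_
  rintro _ ⟨x, rfl⟩
  exact h x

theorem tensorOp_mul (X Y : ∀ n, H n →L[ℂ] H n) :
    tensorOp X * tensorOp Y = tensorOp fun n => X n * Y n :=
  ext_tprod fun x => by simp [tensorOp_tprod]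

theorem tensorOp_one : tensorOp (fun n => (1 : H n →L[ℂ] H n)) = 1 :=
  ext_tprod fun x => by simp [tensorOp_tprod]

theorem adjoint_tensorOp [∀ n, CompleteSpace (H n)] (X : ∀ n, H n →L[ℂ] H n) :
    ContinuousLinearMap.adjoint (tensorOp X)
      = tensorOp fun n => ContinuousLinearMap.adjoint (X n) := by
  refine ext_tprod fun x => ext_inner_tprod fun y => ?_
  rw [ContinuousLinearMap.adjoint_inner_right, tensorOp_tprod, tensorOp_tprod, inner_tprod,
    inner_tprod]
  simp [ContinuousLinearMap.adjoint_inner_right]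

/-- Tensor products of operators depend multilinearly on their factors. -/
def tensorOpMultilinear [DecidableEq ι] : MultilinearMap ℂ (fun n => H n →L[ℂ] H n)
    (HilbertTensor H →L[ℂ] HilbertTensor H) :=
  have e : ∀ (x : ∀ n, H n) (X : ∀ n, H n →L[ℂ] H n), tensorOp X (tprod x)
      = (tprodMultilinear (H := H)).compLinearMap
        (fun n => (ContinuousLinearMap.apply ℂ (H n) (x n)).toLinearMap) X :=
    fun x X => tensorOp_tprod X x
  { toFun := tensorOp
    map_update_add' := fun {_} X i A B => by
      refine ext_tprod fun x => ?_
      rw [add_apply, e, e, e]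
      convert! MultilinearMap.map_update_add _ X i A B
    map_update_smul' := fun {_} X i c A => by
      refine ext_tprod fun x => ?_
      rw [smul_apply, e, e]
      convert! MultilinearMap.map_update_smul _ X i c A }

@[simp] theorem tensorOpMultilinear_apply [DecidableEq ι] (X : ∀ n, H n →L[ℂ] H n) :
    tensorOpMultilinear X = tensorOp X := rfl

/-- Each factor is `Y* Y` with `Y` its square root, and a tensor product of such operators is again
of this form. -/
theorem isPositive_tensorOp [∀ n, CompleteSpace (H n)] {X : ∀ n, H n →L[ℂ] H n}
    (hX : ∀ n, (X n).IsPositive) : (tensorOp X).IsPositive := by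
  have h : ∀ n, ∃ Y : H n →L[ℂ] H n, X n = ContinuousLinearMap.adjoint Y * Y := fun n => by
    have h0 : 0 ≤ X n := (ContinuousLinearMap.nonneg_iff_isPositive _).2 (hX n)
    refine ⟨CFC.sqrt (X n), ?_⟩
    have h1 : IsSelfAdjoint (CFC.sqrt (X n)) := (CFC.sqrt_nonneg (X n)).isSelfAdjoint
    rw [← ContinuousLinearMap.star_eq_adjoint, h1.star_eq, CFC.sqrt_mul_sqrt_self (X n) h0]
  choose Y hY using h
  have : tensorOp X = ContinuousLinearMap.adjoint (tensorOp Y) * tensorOp Y := by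
    rw [adjoint_tensorOp, tensorOp_mul]
    congr 1
    funext n
    exact hY n
  rw [this]
  exact ContinuousLinearMap.isPositive_adjoint_comp_self _

end TensorOp

/-! ### Weak operator convergence -/

section WeakConvergence

variable {E : Type u} [NormedAddCommGroup E] [InnerProductSpace ℂ E]

open Filter Topology

/-- Weak convergence of a bounded sequence of operators may be tested on a set with dense span. -/
theorem tendsto_inner_of_dense {L : ℕ → E →L[ℂ] E} {A : E →L[ℂ] E} {C : ℝ} (hL : ∀ i, ‖L i‖ ≤ C)
    {s : Set E} (hs : Dense (Submodule.span ℂ s : Set E))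
    (h : ∀ x ∈ s, ∀ y ∈ s, Tendsto (fun i => ⟪x, L i y⟫_ℂ) atTop (𝓝 ⟪x, A y⟫_ℂ)) (x y : E) :
    Tendsto (fun i => ⟪x, L i y⟫_ℂ) atTop (𝓝 ⟪x, A y⟫_ℂ) := by
  have hspan : ∀ x ∈ Submodule.span ℂ s, ∀ y ∈ Submodule.span ℂ s,
      Tendsto (fun i => ⟪x, L i y⟫_ℂ) atTop (𝓝 ⟪x, A y⟫_ℂ) := by
    intro x hx y hy
    induction hx using Submodule.span_induction with
    | mem x hx =>
      induction hy using Submodule.span_induction with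
      | mem y hy => exact h x hx y hy
      | zero => simp
      | add a b _ _ ha hb => simpa [inner_add_right] using ha.add hb
      | smul c a _ ha => simpa [inner_smul_right] using ha.const_mul c
    | zero => simp
    | add a b _ _ ha hb => simpa [inner_add_left] using ha.add hb
    | smul c a _ ha => simpa only [inner_smul_left] using ha.const_mul (conj c)
  have hC : 0 ≤ C := (norm_nonneg _).trans (hL 0)
  rw [Metric.tendsto_atTop]
  intro ε hε
  -- `K` bounds every `‖L i - A‖`; the `+ 1` only keeps it positive.
  set K := C + ‖A‖ + 1 with hK
  have hKpos : 0 < K := by positivity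
  obtain ⟨x', hx', hxx⟩ := Metric.dense_iff.1 hs x (ε / (4 * K * (‖y‖ + 1))) (by positivity)
  -- The second error term pairs `y - y'` with `x'`, so `y'` is chosen after `x'`, with a radius
  -- depending on `‖x'‖`.
  obtain ⟨y', hy', hyy⟩ := Metric.dense_iff.1 hs y (ε / (4 * K * (‖x'‖ + 1))) (by positivity)
  rw [Metric.mem_ball, dist_comm, dist_eq_norm] at hx' hy'
  obtain ⟨n, hn⟩ := Metric.tendsto_atTop.1 (hspan x' hxx y' hyy) (ε / 4) (by positivity)
  have hx1 : ‖x - x'‖ * (K * ‖y‖) ≤ ε / 4 := by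
    have h2 : ‖x - x'‖ * (4 * K * (‖y‖ + 1)) < ε := (lt_div_iff₀ (by positivity)).1 hx'
    nlinarith [mul_nonneg (norm_nonneg (x - x')) hKpos.le]
  have hy1 : ‖y - y'‖ * (K * ‖x'‖) ≤ ε / 4 := by
    have h2 : ‖y - y'‖ * (4 * K * (‖x'‖ + 1)) < ε := (lt_div_iff₀ (by positivity)).1 hy'
    nlinarith [mul_nonneg (norm_nonneg (y - y')) hKpos.le]
  refine ⟨n, fun i hi => ?_⟩
  have h3 := hn i hi
  rw [dist_eq_norm] at h3 ⊢
  have e : ⟪x, L i y⟫_ℂ - ⟪x, A y⟫_ℂ = ⟪x - x', (L i - A) y⟫_ℂ + ⟪x', (L i - A) (y - y')⟫_ℂ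
      + (⟪x', L i y'⟫_ℂ - ⟪x', A y'⟫_ℂ) := by
    simp only [inner_sub_left, inner_sub_right, sub_apply, map_sub]
    ring
  have hLA : ‖L i - A‖ ≤ K := (norm_sub_le _ _).trans (by linarith [hL i])
  have b1 : ‖⟪x - x', (L i - A) y⟫_ℂ‖ ≤ ε / 4 := by
    refine ((norm_inner_le_norm _ _).trans ?_).trans hx1
    gcongr
    exact (L i - A).le_of_opNorm_le hLA y
  have b2 : ‖⟪x', (L i - A) (y - y')⟫_ℂ‖ ≤ ε / 4 := by
    refine ((norm_inner_le_norm _ _).trans ?_).trans hy1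
    rw [mul_left_comm, mul_comm, mul_comm ‖y - y'‖, ← mul_assoc, mul_comm K, mul_assoc, mul_comm _ ‖x'‖]
    gcongr
    exact (L i - A).le_of_opNorm_le hLA _
  rw [e]
  calc _ ≤ _ := norm_add₃_le
    _ < ε := by linarith

theorem norm_le_of_isPositive_sub [CompleteSpace E] {A B : E →L[ℂ] E} (hA : A.IsPositive)
    (h : (B - A).IsPositive) : ‖A‖ ≤ ‖B‖ :=
  CStarAlgebra.norm_le_norm_of_nonneg_of_le ((ContinuousLinearMap.nonneg_iff_isPositive _).2 hA)
    ((ContinuousLinearMap.le_def _ _).2 h)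

end WeakConvergence

/-- On simple tensors only the factor at `m` varies, and simple tensors have dense span, so the
uniform norm bound suffices. -/
theorem tendsto_tensorOp_update {ι : Type} [Fintype ι] [DecidableEq ι] {H : ι → Type u}
    [∀ n, NormedAddCommGroup (H n)] [∀ n, InnerProductSpace ℂ (H n)]
    (X : ∀ n, H n →L[ℂ] H n) (m : ι) {L : ℕ → H m →L[ℂ] H m} {A : H m →L[ℂ] H m} {C : ℝ}
    (hL : ∀ i, ‖L i‖ ≤ C)
    (h : ∀ x y, Filter.Tendsto (fun i => ⟪x, L i y⟫_ℂ) Filter.atTop (nhds ⟪x, A y⟫_ℂ))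
    (x y : HilbertTensor H) :
    Filter.Tendsto (fun i => ⟪x, tensorOp (Function.update X m (L i)) y⟫_ℂ) Filter.atTop
      (nhds ⟪x, tensorOp (Function.update X m A) y⟫_ℂ) := by
  refine tendsto_inner_of_dense (C := C * ∏ n ∈ Finset.univ.erase m, ‖X n‖) (fun i => ?_)
    dense_span_tprod ?_ x y
  · refine (norm_tensorOp_le _).trans ?_
    rw [← Finset.mul_prod_erase _ _ (Finset.mem_univ m)]
    rw [Function.update_self, Finset.prod_congr rfl fun n hn => by
      rw [Function.update_of_ne (Finset.ne_of_mem_erase hn)]]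
    gcongr
    exact hL i
  · rintro _ ⟨a, rfl⟩ _ ⟨b, rfl⟩
    have e : ∀ B, ⟪tprod a, tensorOp (Function.update X m B) (tprod b)⟫_ℂ
        = ⟪a m, B (b m)⟫_ℂ * ∏ n ∈ Finset.univ.erase m, ⟪a n, X n (b n)⟫_ℂ := fun B => by
      rw [tensorOp_tprod, inner_tprod, ← Finset.mul_prod_erase _ _ (Finset.mem_univ m)]
      rw [Function.update_self, Finset.prod_congr rfl fun n hn => by
        rw [Function.update_of_ne (Finset.ne_of_mem_erase hn)]]
    simp only [e]
    exact (h _ _).mul_const _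

/-! ### The functional of an ensemble of vectors -/

section Ensemble

variable {K : Type u} [NormedAddCommGroup K] [InnerProductSpace ℂ K] {κ : Type*}

theorem norm_inner_apply_le (v : K) (A : K →L[ℂ] K) : ‖⟪v, A v⟫_ℂ‖ ≤ ‖A‖ * ‖v‖ ^ 2 :=
  calc ‖⟪v, A v⟫_ℂ‖ ≤ ‖v‖ * (‖A‖ * ‖v‖) :=
        (norm_inner_le_norm _ _).trans (by gcongr; exact A.le_opNorm v)
    _ = ‖A‖ * ‖v‖ ^ 2 := by ring

theorem summable_inner_apply {v : κ → K} (hv : Summable fun k => ‖v k‖ ^ 2) (A : K →L[ℂ] K) :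
    Summable fun k => ⟪v k, A (v k)⟫_ℂ :=
  Summable.of_norm_bounded (hv.mul_left ‖A‖) fun k => norm_inner_apply_le (v k) A

/-- The functional `A ↦ ∑ₖ ⟪vₖ, A vₖ⟫` of a square summable family of vectors. -/
def ensemble (v : κ → K) (hv : Summable fun k => ‖v k‖ ^ 2) : (K →L[ℂ] K) →ₗ[ℂ] ℂ where
  toFun A := ∑' k, ⟪v k, A (v k)⟫_ℂ
  map_add' A B := by
    rw [← (summable_inner_apply hv A).tsum_add (summable_inner_apply hv B)]
    simp
  map_smul' c A := by
    simp [tsum_mul_left]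

theorem ensemble_apply (v : κ → K) (hv : Summable fun k => ‖v k‖ ^ 2) (A : K →L[ℂ] K) :
    ensemble v hv A = ∑' k, ⟪v k, A (v k)⟫_ℂ := rfl

theorem summable_norm_sq_apply {v : κ → K} (hv : Summable fun k => ‖v k‖ ^ 2) (B : K →L[ℂ] K) :
    Summable fun k => ‖B (v k)‖ ^ 2 := by
  refine Summable.of_nonneg_of_le (fun k => by positivity) (fun k => ?_) (hv.mul_left (‖B‖ ^ 2))
  rw [← mul_pow]
  gcongr
  exact B.le_opNorm _

theorem ensemble_conjugate [CompleteSpace K] (v : κ → K) (hv : Summable fun k => ‖v k‖ ^ 2)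
    (A B : K →L[ℂ] K) :
    ensemble v hv (ContinuousLinearMap.adjoint B * A * B)
      = ensemble (fun k => B (v k)) (summable_norm_sq_apply hv B) A := by
  simp [ensemble_apply, ContinuousLinearMap.adjoint_inner_right]

theorem ensemble_re_nonneg (v : κ → K) (hv : Summable fun k => ‖v k‖ ^ 2)
    {A : K →L[ℂ] K} (hA : A.IsPositive) : 0 ≤ (ensemble v hv A).re := by
  rw [ensemble_apply, Complex.re_tsum (summable_inner_apply hv A)]
  exact tsum_nonneg fun k => hA.re_inner_nonneg_right (v k)

theorem ensemble_adjoint [CompleteSpace K] (v : κ → K) (hv : Summable fun k => ‖v k‖ ^ 2)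
    (A : K →L[ℂ] K) :
    ensemble v hv (ContinuousLinearMap.adjoint A) = conj (ensemble v hv A) := by
  simp [ensemble_apply, ContinuousLinearMap.adjoint_inner_right, Complex.conj_tsum]

theorem tendsto_ensemble (v : κ → K) (hv : Summable fun k => ‖v k‖ ^ 2) {L : ℕ → K →L[ℂ] K}
    {A : K →L[ℂ] K} {C : ℝ} (hL : ∀ i, ‖L i‖ ≤ C)
    (h : ∀ x y, Filter.Tendsto (fun i => ⟪x, L i y⟫_ℂ) Filter.atTop (nhds ⟪x, A y⟫_ℂ)) :
    Filter.Tendsto (fun i => ensemble v hv (L i)) Filter.atTop (nhds (ensemble v hv A)) := by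
  refine tendsto_tsum_of_dominated_convergence (hv.mul_left C) (fun k => h _ _)
    (Filter.Eventually.of_forall fun i k => (norm_inner_apply_le _ _).trans ?_)
  gcongr
  exact hL i

end Ensemble

/-! ### The trace functional of a state as an ensemble -/

section Trace

variable {K : Type u} [NormedAddCommGroup K] [InnerProductSpace ℂ K] [CompleteSpace K]

omit [CompleteSpace K] in
theorem hasSum_norm_sq_inner {κ : Type*} (b : HilbertBasis κ ℂ K) (x : K) :
    HasSum (fun j => ‖⟪b j, x⟫_ℂ‖ ^ 2) (‖x‖ ^ 2) := by
  have h := Complex.hasSum_re (b.hasSum_inner_mul_inner x x)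
  have e : (⟪x, x⟫_ℂ).re = ‖x‖ ^ 2 := inner_self_eq_norm_sq (𝕜 := ℂ) x
  rw [e] at h
  refine h.congr_fun fun j => ?_
  rw [← inner_conj_symm x (b j), Complex.conj_mul', ← Complex.ofReal_pow, Complex.ofReal_re]

omit [CompleteSpace K] in
theorem summable_norm_sq_matrix {κ : Type*} (b : HilbertBasis κ ℂ K) {A : K →L[ℂ] K}
    (hA : Summable fun i => ‖A (b i)‖ ^ 2) :
    Summable fun p : κ × κ => ‖⟪b p.2, A (b p.1)⟫_ℂ‖ ^ 2 := by
  refine (summable_prod_of_nonneg fun p => by positivity).2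
    ⟨fun i => (hasSum_norm_sq_inner b (A (b i))).summable, ?_⟩
  simpa only [(hasSum_norm_sq_inner b _).tsum_eq] using hA

/-- Cyclicity of the trace: `∑ᵢ ⟪R bᵢ, R A bᵢ⟫ = ∑ⱼ ⟪R bⱼ, A R bⱼ⟫` for a self-adjoint
Hilbert-Schmidt operator `R`. -/
theorem tsum_inner_cyclic {κ : Type*} (b : HilbertBasis κ ℂ K) {R : K →L[ℂ] K}
    (hR : ContinuousLinearMap.adjoint R = R) (hs : Summable fun i => ‖R (b i)‖ ^ 2)
    (A : K →L[ℂ] K) :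
    ∑' i, ⟪R (b i), R (A (b i))⟫_ℂ = ∑' j, ⟪R (b j), A (R (b j))⟫_ℂ := by
  have hsym : ∀ x y, ⟪R x, y⟫_ℂ = ⟪x, R y⟫_ℂ := fun x y => by
    conv_lhs => rw [← hR]
    exact ContinuousLinearMap.adjoint_inner_left R y x
  -- Summing over `j` gives the left side and over `i` the right side, both by Parseval. The claim
  -- is Fubini for this double series.
  set f : κ → κ → ℂ := fun i j => ⟪R (b i), b j⟫_ℂ * ⟪b j, R (A (b i))⟫_ℂ with hf
  have e1 : ∀ i, ∑' j, f i j = ⟪R (b i), R (A (b i))⟫_ℂ := fun i => b.tsum_inner_mul_inner _ _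
  have e2 : ∀ j, ∑' i, f i j = ⟪R (b j), A (R (b j))⟫_ℂ := fun j => by
    rw [← ContinuousLinearMap.adjoint_inner_left, ← b.tsum_inner_mul_inner]
    refine tsum_congr fun i => ?_
    rw [hf, mul_comm]
    simp only [hsym, ContinuousLinearMap.adjoint_inner_left]
  have s1 : Summable fun p : κ × κ => ‖⟪b p.2, R (b p.1)⟫_ℂ‖ ^ 2 := summable_norm_sq_matrix b hs
  have s2 : Summable fun p : κ × κ => ‖⟪b p.1, (ContinuousLinearMap.adjoint A * R) (b p.2)⟫_ℂ‖ ^ 2 :=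
    (summable_norm_sq_matrix b (A := ContinuousLinearMap.adjoint A * R)
      (summable_norm_sq_apply hs (ContinuousLinearMap.adjoint A))).prod_symm
  have s3 : Summable (Function.uncurry f) := by
    -- Each term is a product of two square summable matrix elements, so `|x y| ≤ x² + y²` gives
    -- absolute convergence.
    refine Summable.of_norm_bounded (s1.add s2) fun p => ?_
    have h1 : ‖⟪R (b p.1), b p.2⟫_ℂ‖ = ‖⟪b p.2, R (b p.1)⟫_ℂ‖ := norm_inner_symm _ _
    have h2 : ‖⟪b p.2, R (A (b p.1))⟫_ℂ‖
        = ‖⟪b p.1, (ContinuousLinearMap.adjoint A * R) (b p.2)⟫_ℂ‖ := by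
      rw [← hsym, ← ContinuousLinearMap.adjoint_inner_left, norm_inner_symm]
      rfl
    simp only [Function.uncurry, hf, norm_mul, h1, h2]
    nlinarith [sq_nonneg (‖⟪b p.2, R (b p.1)⟫_ℂ‖ -
      ‖⟪b p.1, (ContinuousLinearMap.adjoint A * R) (b p.2)⟫_ℂ‖), sq_nonneg (‖⟪b p.2, R (b p.1)⟫_ℂ‖),
      sq_nonneg ‖⟪b p.1, (ContinuousLinearMap.adjoint A * R) (b p.2)⟫_ℂ‖]
  simp only [← e1, ← e2]
  exact s3.tsum_comm.symm

/-- The vectors are `√ρ` applied to the basis underlying `trace`. Trace one makes `√ρ`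
Hilbert-Schmidt, and `tsum_inner_cyclic` moves one factor `√ρ` across `A`. From here on the state
enters only through this functional. -/
theorem exists_ensemble {ρ : K →L[ℂ] K} (hρ : IsState ρ) :
    ∃ (κ : Set K) (v : κ → K) (hv : Summable fun k => ‖v k‖ ^ 2),
      ensemble v hv 1 = 1 ∧ ∀ A, trace (ρ ∘L A) = ensemble v hv A := by
  set b := (exists_hilbertBasis ℂ K).choose_spec.choose with hb
  have h0 : 0 ≤ ρ := (ContinuousLinearMap.nonneg_iff_isPositive _).2 hρ.1
  set R := CFC.sqrt ρ with hR
  have hRR : ∀ x, R (R x) = ρ x := fun x =>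
    congrArg (fun T : K →L[ℂ] K => T x) (CFC.sqrt_mul_sqrt_self ρ h0)
  have hRa : ContinuousLinearMap.adjoint R = R := (CFC.sqrt_nonneg ρ).isSelfAdjoint.star_eq
  have hsym : ∀ x y, ⟪R x, y⟫_ℂ = ⟪x, R y⟫_ℂ := fun x y => by
    conv_lhs => rw [← hRa]
    exact ContinuousLinearMap.adjoint_inner_left R y x
  have hsum := hρ.2 _ b
  have hv : Summable fun k => ‖R (b k)‖ ^ 2 := by
    refine (Complex.hasSum_re hsum).summable.congr fun k => ?_
    rw [← hRR, ← hsym]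
    exact inner_self_eq_norm_sq (𝕜 := ℂ) _
  refine ⟨_, fun k => R (b k), hv, ?_, fun A => ?_⟩
  · rw [ensemble_apply, ← hsum.tsum_eq]
    refine tsum_congr fun k => ?_
    rw [← hRR, ← hsym]
    rfl
  · rw [ensemble_apply, ← tsum_inner_cyclic b hRa hv]
    refine tsum_congr fun k => ?_
    rw [hsym, hRR]
    rfl

end Trace

/-! ### Normal positive functionals and the distributions of measurements -/

section Normal

variable {E : Type u} [NormedAddCommGroup E] [InnerProductSpace ℂ E]

/-- A positive functional that is countably additive on weakly summable positive series. -/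
structure IsNormal (σ : (E →L[ℂ] E) → ℝ) : Prop where
  nonneg : ∀ A, A.IsPositive → 0 ≤ σ A
  hasSum : ∀ (A : ℕ → E →L[ℂ] E) (B : E →L[ℂ] E), (∀ i, (A i).IsPositive) → B.IsPositive →
    (∀ x y, HasSum (fun i => ⟪x, A i y⟫_ℂ) ⟪x, B y⟫_ℂ) → HasSum (fun i => σ (A i)) (σ B)

theorem isNormal_inner (x : E) : IsNormal fun A => (⟪x, A x⟫_ℂ).re where
  nonneg _ hA := hA.re_inner_nonneg_right x
  hasSum _ _ _ _ h := Complex.hasSum_re (h x x)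

/-- Fixing positive operators at the other sites yields the unnormalized conditional state at `m`.
Countable additivity holds because the partial sums converge weakly and are bounded in norm, so
dominated convergence applies to the ensemble. -/
theorem isNormal_ensemble {ι : Type} [Fintype ι] [DecidableEq ι] {H : ι → Type u}
    [∀ n, NormedAddCommGroup (H n)] [∀ n, InnerProductSpace ℂ (H n)] [∀ n, CompleteSpace (H n)]
    {κ : Type*} (v : κ → HilbertTensor H) (hv : Summable fun k => ‖v k‖ ^ 2)
    {X : ∀ n, H n →L[ℂ] H n} (m : ι) (hX : ∀ n, n ≠ m → (X n).IsPositive) :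
    IsNormal fun A => (ensemble v hv (tensorOp (Function.update X m A))).re := by
  have hpos : ∀ A : H m →L[ℂ] H m, A.IsPositive →
      (tensorOp (Function.update X m A)).IsPositive := fun A hA => by
    refine isPositive_tensorOp fun n => ?_
    by_cases h : n = m
    · subst h; simpa using hA
    · simpa [h] using hX n h
  refine ⟨fun A hA => ensemble_re_nonneg v hv (hpos A hA), fun A B hA hB h => ?_⟩
  rw [hasSum_iff_tendsto_nat_of_nonneg fun i => ensemble_re_nonneg v hv (hpos _ (hA i))]
  have e : ∀ n, ∑ i ∈ Finset.range n, (ensemble v hv (tensorOp (Function.update X m (A i)))).re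
      = (ensemble v hv (tensorOp (Function.update X m (∑ i ∈ Finset.range n, A i)))).re := by
    intro n
    rw [← Complex.re_sum, ← map_sum]
    simp only [← tensorOpMultilinear_apply]
    rw [MultilinearMap.map_update_sum]
  simp only [e]
  have hw : ∀ x y, Filter.Tendsto (fun n => ⟪x, (∑ i ∈ Finset.range n, A i) y⟫_ℂ) Filter.atTop
      (nhds ⟪x, B y⟫_ℂ) := fun x y => by
    simpa [inner_sum] using (h x y).tendsto_sum_nat
  -- Partial sums of positive operators lie between `0` and the weak sum `B`, and the norm is
  -- monotone on positive operators.
  have hb : ∀ n, ‖∑ i ∈ Finset.range n, A i‖ ≤ ‖B‖ := fun n => by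
    have hp : (∑ i ∈ Finset.range n, A i).IsPositive := by
      rw [← ContinuousLinearMap.nonneg_iff_isPositive]
      exact Finset.sum_nonneg fun i _ => (ContinuousLinearMap.nonneg_iff_isPositive _).2 (hA i)
    refine norm_le_of_isPositive_sub hp ((ContinuousLinearMap.isPositive_iff_complex _).2 fun x => ?_)
    have hnn : ∀ i, 0 ≤ ⟪A i x, x⟫_ℂ := fun i => (hA i).inner_nonneg_left x
    have hs : HasSum (fun i => ⟪A i x, x⟫_ℂ) ⟪B x, x⟫_ℂ := by
      simpa only [RingHomCompTriple.comp_apply, RingHom.id_apply, starRingEnd_apply,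
        ← starRingEnd_apply, inner_conj_symm] using Complex.hasSum_conj'.2 (h x x)
    have hle : ∑ i ∈ Finset.range n, ⟪A i x, x⟫_ℂ ≤ ⟪B x, x⟫_ℂ :=
      sum_le_hasSum _ (fun i _ => hnn i) hs
    have h3 : (0 : ℂ) ≤ ⟪(B - ∑ i ∈ Finset.range n, A i) x, x⟫_ℂ := by
      rw [sub_apply, inner_sub_left, sub_nonneg]
      simpa [sum_inner] using hle
    exact ⟨Complex.ext (by simp) ((Complex.ofReal_im _).trans (Complex.le_def.1 h3).2), (Complex.le_def.1 h3).1⟩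
  have hC : ∀ n, ‖tensorOp (Function.update X m (∑ i ∈ Finset.range n, A i))‖
      ≤ ‖B‖ * ∏ n ∈ Finset.univ.erase m, ‖X n‖ := fun n => by
    refine (norm_tensorOp_le _).trans ?_
    rw [← Finset.mul_prod_erase _ _ (Finset.mem_univ m)]
    rw [Function.update_self, Finset.prod_congr rfl fun n hn => by
      rw [Function.update_of_ne (Finset.ne_of_mem_erase hn)]]
    gcongr
    exact hb n
  exact (Complex.continuous_re.tendsto _).comp
    (tendsto_ensemble v hv hC (tendsto_tensorOp_update X m hb hw))

variable {σ : (E →L[ℂ] E) → ℝ} {Λ : Type w} [MeasurableSpace Λ]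

/-- Countable additivity for the constant sequence `∅` makes a constant series summable, which
forces its terms to vanish. -/
theorem POVM.op_empty (M : POVM Λ E) : M.op ∅ = 0 := by
  refine ContinuousLinearMap.ext fun y => ext_inner_left ℂ fun x => ?_
  have h := (M.hasSum_iUnion (fun _ => ∅) (fun _ => MeasurableSet.empty)
    (fun _ _ _ => disjoint_bot_left) x y).summable
  simpa [summable_const_iff] using h

theorem IsNormal.map_zero (hσ : IsNormal σ) : σ 0 = 0 := by
  have h := (hσ.hasSum (fun _ => 0) 0 (fun _ => ContinuousLinearMap.isPositive_zero)
    ContinuousLinearMap.isPositive_zero (fun x y => by simp)).summable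
  simpa [summable_const_iff] using h

theorem IsNormal.hasSum_povm (hσ : IsNormal σ) (M : POVM Λ E) {F : ℕ → Set Λ}
    (hF : ∀ i, MeasurableSet (F i)) (hd : Pairwise (Function.onFun Disjoint F)) :
    HasSum (fun i => σ (M.op (F i))) (σ (M.op (⋃ i, F i))) :=
  hσ.hasSum _ _ (fun i => M.isPositive _ (hF i)) (M.isPositive _ (MeasurableSet.iUnion hF))
    (M.hasSum_iUnion F hF hd)

/-- The distribution of the outcomes of a measurement under a normal positive functional. -/
def POVM.law (M : POVM Λ E) (hσ : IsNormal σ) : Measure Λ :=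
  Measure.ofMeasurable (fun F _ => ENNReal.ofReal (σ (M.op F)))
    (by simp [M.op_empty, hσ.map_zero])
    (fun F hF hd => by
      have h := hσ.hasSum_povm M hF hd
      rw [← h.tsum_eq, ENNReal.ofReal_tsum_of_nonneg
        (fun i => hσ.nonneg _ (M.isPositive _ (hF i))) h.summable])

theorem POVM.law_apply (M : POVM Λ E) (hσ : IsNormal σ) {F : Set Λ} (hF : MeasurableSet F) :
    M.law hσ F = ENNReal.ofReal (σ (M.op F)) :=
  Measure.ofMeasurable_apply F hF

theorem POVM.law_real (M : POVM Λ E) (hσ : IsNormal σ) {F : Set Λ} (hF : MeasurableSet F) :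
    (M.law hσ).real F = σ (M.op F) := by
  rw [Measure.real, M.law_apply hσ hF, ENNReal.toReal_ofReal (hσ.nonneg _ (M.isPositive _ hF))]

instance (M : POVM Λ E) (hσ : IsNormal σ) : IsFiniteMeasure (M.law hσ) :=
  ⟨by rw [M.law_apply hσ MeasurableSet.univ]; exact ENNReal.ofReal_lt_top⟩

/-- A joint measure for finitely many measurements of one system with the distributions of the
single measurements as marginals. -/
theorem exists_jointLaw {S : ℕ} (M : Fin S → POVM Λ E) (hσ : IsNormal σ) :
    ∃ ν : Measure (Fin S → Λ), IsFiniteMeasure ν ∧ ν.real Set.univ = σ 1 ∧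
      ∀ s F, MeasurableSet F → ν.real {ω | ω s ∈ F} = σ ((M s).op F) := by
  have h1 : 0 ≤ σ 1 := hσ.nonneg _ ContinuousLinearMap.isPositive_one
  have huniv : ∀ s, ((M s).law hσ) Set.univ = ENNReal.ofReal (σ 1) := fun s => by
    rw [(M s).law_apply hσ MeasurableSet.univ, (M s).op_univ]
  rcases h1.eq_or_lt with h0 | h0
  · refine ⟨0, inferInstance, by simp [← h0], fun s F hF => ?_⟩
    rw [← (M s).law_real hσ hF]
    have : (M s).law hσ = 0 := by rw [← Measure.measure_univ_eq_zero, huniv, ← h0]; simp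
    simp [this]
  -- Any coupling of the laws would do; the product is used. Dividing each factor by the common mass
  -- `c` and multiplying once by `c` keeps both the marginals and the total mass right.
  · set c := ENNReal.ofReal (σ 1) with hc
    have hc0 : c ≠ 0 := by simp [hc, h0]
    have hct : c ≠ ⊤ := ENNReal.ofReal_ne_top
    have hp : ∀ s, IsProbabilityMeasure (c⁻¹ • (M s).law hσ) := fun s =>
      ⟨by simp [huniv, ENNReal.inv_mul_cancel hc0 hct]⟩
    refine ⟨c • Measure.pi fun s => c⁻¹ • (M s).law hσ, ⟨?_⟩, ?_, fun s F hF => ?_⟩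
    · simp [hct.lt_top]
    · simp [Measure.real, hc, h1]
    · have e := (measurePreserving_eval (fun s => c⁻¹ • (M s).law hσ) s).measure_preimage
        hF.nullMeasurableSet
      have e2 : (Measure.pi fun s => c⁻¹ • (M s).law hσ) {ω | ω s ∈ F} = c⁻¹ * (M s).law hσ F :=
        e.trans (by simp)
      rw [← (M s).law_real hσ hF, Measure.real, Measure.smul_apply, e2, smul_eq_mul, ← mul_assoc,
        ENNReal.mul_inv_cancel hc0 hct, one_mul, Measure.real]

end Normal

/-! ### Signed measures simulating a correlation scenario -/

/-- On the positive Hahn set the difference is at most `μ₁`, and on its complement the negated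
difference is at most `μ₂`. -/
theorem totalVariation_sub_le {α : Type*} [MeasurableSpace α] (μ₁ μ₂ : Measure α)
    [IsFiniteMeasure μ₁] [IsFiniteMeasure μ₂] :
    (μ₁.toSignedMeasure - μ₂.toSignedMeasure).totalVariation Set.univ
      ≤ μ₁ Set.univ + μ₂ Set.univ := by
  set μ := μ₁.toSignedMeasure - μ₂.toSignedMeasure with hμ
  obtain ⟨i, hi, hi0, hi1, hp, hn⟩ := μ.toJordanDecomposition_spec
  have hval : ∀ A, MeasurableSet A → μ A = μ₁.real A - μ₂.real A := fun A hA => by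
    simp [hμ, hA]
  rw [SignedMeasure.totalVariation, hp, hn, Measure.add_apply,
    SignedMeasure.toMeasureOfZeroLE_apply _ hi0 hi MeasurableSet.univ,
    SignedMeasure.toMeasureOfLEZero_apply _ hi1 hi.compl MeasurableSet.univ]
  refine add_le_add ?_ ?_
  · refine le_trans ?_ (measure_mono (Set.subset_univ i))
    rw [← ENNReal.ofReal_toReal (measure_ne_top μ₁ i), ← Measure.real,
      ENNReal.ofReal, ENNReal.coe_le_coe, ← NNReal.coe_le_coe, Real.coe_toNNReal _ measureReal_nonneg]
    simp only [Set.inter_univ, NNReal.coe_mk, hval i hi]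
    linarith [measureReal_nonneg (μ := μ₂) (s := i)]
  · refine le_trans ?_ (measure_mono (Set.subset_univ iᶜ))
    rw [← ENNReal.ofReal_toReal (measure_ne_top μ₂ iᶜ), ← Measure.real,
      ENNReal.ofReal, ENNReal.coe_le_coe, ← NNReal.coe_le_coe, Real.coe_toNNReal _ measureReal_nonneg]
    simp only [Set.inter_univ, NNReal.coe_mk, hval _ hi.compl]
    linarith [measureReal_nonneg (μ := μ₁) (s := iᶜ)]

section Simulation

variable {N : ℕ} {H : Fin N → Type u} [∀ n, NormedAddCommGroup (H n)]
  [∀ n, InnerProductSpace ℂ (H n)] [∀ n, CompleteSpace (H n)]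
  {S : Fin N → ℕ} {Λ : Fin N → Type w} [∀ n, MeasurableSpace (Λ n)]

theorem measurableSet_cylinder (s : ∀ n, Fin (S n)) {F : ∀ n, Set (Λ n)}
    (hF : ∀ n, MeasurableSet (F n)) :
    MeasurableSet {ω : ∀ n, Fin (S n) → Λ n | ∀ n, ω n (s n) ∈ F n} := by
  rw [Set.ofPred_forall]
  exact MeasurableSet.iInter fun n => (by fun_prop : Measurable fun ω : ∀ n, Fin (S n) → Λ n =>
    ω n (s n)) (hF n)

omit [∀ n, CompleteSpace (H n)] in
/-- A finite linear combination of positive measures with the joint distributions of the scenario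
as marginals bounds the scenario parameter. -/
theorem gammaParam_le {ρ : HilbertTensor H →L[ℂ] HilbertTensor H}
    {M : ∀ n, Fin (S n) → POVM (Λ n) (H n)} {A : Type*} [Fintype A] (c : A → ℝ)
    (μ : A → Measure (∀ n, Fin (S n) → Λ n)) [∀ a, IsFiniteMeasure (μ a)]
    (h : ∀ (s : ∀ n, Fin (S n)) (F : ∀ n, Set (Λ n)), (∀ n, MeasurableSet (F n)) →
      ((∑ a, c a * (μ a).real {ω | ∀ n, ω n (s n) ∈ F n} : ℝ) : ℂ) = jointProb ρ M s F)
    (s₀ : ∀ n, Fin (S n)) (h₀ : jointProb ρ M s₀ (fun _ => Set.univ) = 1) :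
    gammaParam ρ M ≤ ENNReal.ofReal (∑ a, |c a| * (μ a).real Set.univ) := by
  have hfin : ∀ (b : A → ℝ), IsFiniteMeasure (∑ a, ENNReal.ofReal (b a) • μ a) := fun b =>
    ⟨by simp [ENNReal.mul_lt_top]⟩
  have hreal : ∀ (b : A → ℝ), (∀ a, 0 ≤ b a) → ∀ B,
      (∑ a, ENNReal.ofReal (b a) • μ a).real B = ∑ a, b a * (μ a).real B := fun b hb B => by
    rw [Measure.real, Measure.finsetSum_apply, ENNReal.toReal_sum]
    · simp [Measure.real, hb]
    · intro a _
      exact ENNReal.mul_ne_top ENNReal.ofReal_ne_top (measure_ne_top _ _)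
  -- Sorting the terms by the sign of `c a` writes the combination as a difference of two finite
  -- measures whose masses add up to the cost.
  set μ₁ := ∑ a, ENNReal.ofReal (max (c a) 0) • μ a with hμ₁
  set μ₂ := ∑ a, ENNReal.ofReal (max (-c a) 0) • μ a with hμ₂
  have : IsFiniteMeasure μ₁ := hfin _
  have : IsFiniteMeasure μ₂ := hfin _
  have hval : ∀ B, MeasurableSet B → (μ₁.toSignedMeasure - μ₂.toSignedMeasure) B
      = ∑ a, c a * (μ a).real B := fun B hB => by
    have e : (μ₁.toSignedMeasure - μ₂.toSignedMeasure) B = μ₁.real B - μ₂.real B := by simp [hB]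
    rw [e, hreal _ (fun a => le_max_right _ _), hreal _ (fun a => le_max_right _ _),
      ← Finset.sum_sub_distrib]
    refine Finset.sum_congr rfl fun a _ => ?_
    rw [← sub_mul]
    congr 1
    rcases le_total (c a) 0 with h | h
    · rw [max_eq_right h, max_eq_left (by linarith)]; ring
    · rw [max_eq_left h, max_eq_right (by linarith)]; ring
  have hsim : Simulates ρ M (μ₁.toSignedMeasure - μ₂.toSignedMeasure) := by
    have key : ∀ (s : ∀ n, Fin (S n)) (F : ∀ n, Set (Λ n)), (∀ n, MeasurableSet (F n)) →
        (((μ₁.toSignedMeasure - μ₂.toSignedMeasure) {ω | ∀ n, ω n (s n) ∈ F n} : ℝ) : ℂ)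
          = jointProb ρ M s F := fun s F hF => by rw [hval _ (measurableSet_cylinder s hF), h s F hF]
    refine ⟨?_, key⟩
    -- Total mass one is the marginal condition for the full rectangle; it takes one joint setting
    -- `s₀` to read it off.
    have := key s₀ (fun _ => Set.univ) fun _ => MeasurableSet.univ
    rw [h₀, Complex.ofReal_eq_one] at this
    simpa using this
  refine (iInf₂_le _ hsim).trans ((totalVariation_sub_le μ₁ μ₂).trans_eq ?_)
  rw [← ENNReal.ofReal_toReal (measure_ne_top μ₁ _), ← ENNReal.ofReal_toReal (measure_ne_top μ₂ _),
    ← ENNReal.ofReal_add ENNReal.toReal_nonneg ENNReal.toReal_nonneg, ← Measure.real, ← Measure.real,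
    hreal _ (fun a => le_max_right _ _), hreal _ (fun a => le_max_right _ _),
    ← Finset.sum_add_distrib]
  congr 1
  refine Finset.sum_congr rfl fun a _ => ?_
  rw [← add_mul]
  congr 1
  rcases le_total (c a) 0 with h | h
  · rw [max_eq_right h, max_eq_left (by linarith), abs_of_nonpos h]; ring
  · rw [max_eq_left h, max_eq_right (by linarith), abs_of_nonneg h]; ring

omit [∀ n, CompleteSpace (H n)] in
/-- Products of normal positive functionals are simulated by product measures. -/
theorem exists_measure_prod (M : ∀ n, Fin (S n) → POVM (Λ n) (H n))
    {σ : ∀ n, (H n →L[ℂ] H n) → ℝ} (hσ : ∀ n, IsNormal (σ n)) :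
    ∃ μ : Measure (∀ n, Fin (S n) → Λ n), IsFiniteMeasure μ ∧ μ.real Set.univ = ∏ n, σ n 1 ∧
      ∀ (s : ∀ n, Fin (S n)) (F : ∀ n, Set (Λ n)), (∀ n, MeasurableSet (F n)) →
        μ.real {ω | ∀ n, ω n (s n) ∈ F n} = ∏ n, σ n ((M n (s n)).op (F n)) := by
  choose ν hfin huniv hν using fun n => exists_jointLaw (M n) (hσ n)
  refine ⟨Measure.pi ν, inferInstance, ?_, fun s F hF => ?_⟩
  · rw [Measure.real, Measure.pi_univ, ENNReal.toReal_prod]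
    exact Finset.prod_congr rfl fun n _ => huniv n
  · have e : {ω : ∀ n, Fin (S n) → Λ n | ∀ n, ω n (s n) ∈ F n}
        = Set.univ.pi fun n => {x | x (s n) ∈ F n} := by ext; simp
    rw [e, Measure.real, Measure.pi_pi, ENNReal.toReal_prod]
    exact Finset.prod_congr rfl fun n _ => hν n (s n) (F n) (hF n)

/-- The function `φ` of a joint setting `s` and a rectangle `F` is a finite linear combination of
positive measures on `∏ₙ Λₙ^{Sₙ}`, evaluated on the corresponding cylinders, of total cost at most
`C`. -/
def IsSimulated (φ : (∀ n, Fin (S n)) → (∀ n, Set (Λ n)) → ℝ) (C : ℝ) : Prop :=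
  ∃ (A : Type) (_ : Fintype A) (c : A → ℝ) (μ : A → Measure (∀ n, Fin (S n) → Λ n)),
    (∀ a, IsFiniteMeasure (μ a)) ∧
    (∀ (s : ∀ n, Fin (S n)) (F : ∀ n, Set (Λ n)), (∀ n, MeasurableSet (F n)) →
      φ s F = ∑ a, c a * (μ a).real {ω | ∀ n, ω n (s n) ∈ F n}) ∧
    ∑ a, |c a| * (μ a).real Set.univ ≤ C

theorem IsSimulated.of_measure (μ : Measure (∀ n, Fin (S n) → Λ n)) [IsFiniteMeasure μ] :
    IsSimulated (fun s (F : ∀ n, Set (Λ n)) => μ.real {ω | ∀ n, ω n (s n) ∈ F n})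
      (μ.real Set.univ) :=
  ⟨Unit, inferInstance, fun _ => 1, fun _ => μ, fun _ => inferInstance, by simp, by simp⟩

theorem IsSimulated.congr {φ φ' : (∀ n, Fin (S n)) → (∀ n, Set (Λ n)) → ℝ} {C C' : ℝ}
    (h : IsSimulated φ C)
    (e : ∀ s F, (∀ n, MeasurableSet (F n)) → φ' s F = φ s F) (hC : C ≤ C') :
    IsSimulated φ' C' := by
  obtain ⟨A, i, c, μ, h1, h2, h3⟩ := h
  exact ⟨A, i, c, μ, h1, fun s F hF => (e s F hF).trans (h2 s F hF), h3.trans hC⟩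

theorem IsSimulated.sum {B : Type} [Fintype B] (b : B → ℝ)
    {φ : B → (∀ n, Fin (S n)) → (∀ n, Set (Λ n)) → ℝ} {C : B → ℝ}
    (h : ∀ i, IsSimulated (φ i) (C i)) :
    IsSimulated (fun s F => ∑ i, b i * φ i s F) (∑ i, |b i| * C i) := by
  choose A hA c μ h1 h2 h3 using h
  refine ⟨Σ i, A i, inferInstance, fun p => b p.1 * c p.1 p.2, fun p => μ p.1 p.2,
    fun p => h1 _ _, fun s F hF => ?_, ?_⟩
  · rw [Fintype.sum_sigma]
    refine Finset.sum_congr rfl fun i _ => ?_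
    rw [h2 i s F hF, Finset.mul_sum]
    exact Finset.sum_congr rfl fun a _ => by ring
  · rw [Fintype.sum_sigma]
    refine Finset.sum_le_sum fun i _ => ?_
    refine le_trans (le_of_eq ?_) (mul_le_mul_of_nonneg_left (h3 i) (abs_nonneg (b i)))
    rw [Finset.mul_sum]
    exact Finset.sum_congr rfl fun a _ => by rw [abs_mul]; ring

omit [∀ n, CompleteSpace (H n)] in
theorem IsSimulated.gammaParam_le {ρ : HilbertTensor H →L[ℂ] HilbertTensor H}
    {M : ∀ n, Fin (S n) → POVM (Λ n) (H n)} {C : ℝ}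
    {φ : (∀ n, Fin (S n)) → (∀ n, Set (Λ n)) → ℝ} (h : IsSimulated φ C)
    (hφ : ∀ (s : ∀ n, Fin (S n)) (F : ∀ n, Set (Λ n)), (∀ n, MeasurableSet (F n)) →
      (φ s F : ℂ) = jointProb ρ M s F)
    (s₀ : ∀ n, Fin (S n)) (h₀ : jointProb ρ M s₀ (fun _ => Set.univ) = 1) :
    gammaParam ρ M ≤ ENNReal.ofReal C := by
  obtain ⟨A, i, c, μ, h1, h2, h3⟩ := h
  refine (BellViolation.gammaParam_le c μ (fun s F hF => ?_) s₀ h₀).trans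
    (ENNReal.ofReal_le_ofReal h3)
  rw [← h2 s F hF, hφ s F hF]

omit [∀ n, CompleteSpace (H n)] in
theorem isSimulated_prod (M : ∀ n, Fin (S n) → POVM (Λ n) (H n))
    {σ : ∀ n, (H n →L[ℂ] H n) → ℝ} (hσ : ∀ n, IsNormal (σ n)) :
    IsSimulated (fun s (F : ∀ n, Set (Λ n)) => ∏ n, σ n ((M n (s n)).op (F n))) (∏ n, σ n 1) := by
  obtain ⟨μ, hμ, h1, h2⟩ := exists_measure_prod M hσ
  exact (IsSimulated.of_measure μ).congr (fun s F hF => (h2 s F hF).symm) h1.le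

end Simulation

/-! ### Decomposition into product functionals and the dimension bound -/

section Polarization

variable {E : Type u} [NormedAddCommGroup E] [InnerProductSpace ℂ E]

/-- Matrix elements in an orthonormal family are combinations of expectation values at unit
vectors, with coefficients of total modulus at most `2`. -/
theorem exists_polarization {α : Type*} {e : α → E} (he : Orthonormal ℂ e) (a b : α) :
    ∃ (κ : Fin 4 → ℂ) (η : Fin 4 → E), ∑ k, ‖κ k‖ ≤ 2 ∧ (∀ k, ‖η k‖ = 1) ∧
      ∀ X : E →L[ℂ] E, ⟪e a, X (e b)⟫_ℂ = ∑ k, κ k * ⟪η k, X (η k)⟫_ℂ := by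
  classical
  by_cases hab : a = b
  · subst hab
    refine ⟨Pi.single 0 1, fun _ => e a, ?_, fun _ => he.1 a, fun X => ?_⟩
    · simp [Fin.sum_univ_four, Pi.single_apply]
    · simp [Pi.single_apply]
  · have h2 : (Real.sqrt 2 : ℂ) ≠ 0 := by simp
    have hs : (Real.sqrt 2 : ℂ)⁻¹ * (Real.sqrt 2 : ℂ)⁻¹ = 1 / 2 := by
      rw [← mul_inv, ← Complex.ofReal_mul, Real.mul_self_sqrt (by norm_num)]
      norm_num
    -- Polarization with the vectors `(e a + iᵏ e b) / √2`. They are unit vectors by orthogonality;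
    -- normalizing turns the usual coefficients of modulus `1/4` into `1/2`, so the four moduli add
    -- up to `2`.
    refine ⟨![1 / 2, -Complex.I / 2, -1 / 2, Complex.I / 2], fun k =>
      (Real.sqrt 2 : ℂ)⁻¹ • (e a + (![1, Complex.I, -1, -Complex.I] k) • e b), ?_, fun k => ?_,
      fun X => ?_⟩
    · simp [Fin.sum_univ_four]
      norm_num
    · have hu : ‖(![1, Complex.I, -1, -Complex.I] : Fin 4 → ℂ) k‖ = 1 := by
        fin_cases k <;> simp
      set c := (![1, Complex.I, -1, -Complex.I] : Fin 4 → ℂ) k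
      have h3 : ‖e a + c • e b‖ * ‖e a + c • e b‖ = 2 := by
        rw [norm_add_sq_eq_norm_sq_add_norm_sq_of_inner_eq_zero (𝕜 := ℂ)]
        · rw [norm_smul, hu, he.1 a, he.1 b]; norm_num
        · rw [inner_smul_right, he.2 hab, mul_zero]
      have h4 : ‖e a + c • e b‖ = Real.sqrt 2 := by
        rw [← h3, Real.sqrt_mul_self (norm_nonneg _)]
      rw [norm_smul, h4, norm_inv, Complex.norm_real, Real.norm_of_nonneg (Real.sqrt_nonneg 2),
        inv_mul_cancel₀ (by simp)]
    · simp only [map_smul, map_add, inner_smul_left, inner_smul_right, inner_add_left,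
        inner_add_right, Fin.sum_univ_four]
      simp only [map_inv₀, Complex.conj_ofReal, Matrix.cons_val_zero, Matrix.cons_val_one,
        Matrix.cons_val, map_one, map_neg, Complex.conj_I]
      have hI := Complex.I_mul_I
      generalize ⟪e a, X (e a)⟫_ℂ = p
      generalize ⟪e a, X (e b)⟫_ℂ = q
      generalize ⟪e b, X (e a)⟫_ℂ = r
      generalize ⟪e b, X (e b)⟫_ℂ = t
      generalize (Real.sqrt 2 : ℂ)⁻¹ = c at hs
      linear_combination (-2 * q) * hs + (c * c * (q - r)) * hI

end Polarization

/-! ### Polarization of the ensemble functional -/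

section Ensemble

variable {K : Type u} [NormedAddCommGroup K] [InnerProductSpace ℂ K] [CompleteSpace K]
  {κ : Type*} (v : κ → K) (hv : Summable fun k => ‖v k‖ ^ 2)

theorem ensemble_star_mul_mul (A B : K →L[ℂ] K) :
    ensemble v hv (star B * A * B) = ensemble (fun k => B (v k)) (summable_norm_sq_apply hv B) A :=
  ensemble_conjugate v hv A B

theorem ensemble_star (A : K →L[ℂ] K) : ensemble v hv (star A) = conj (ensemble v hv A) :=
  ensemble_adjoint v hv A

theorem exists_phase (z : ℂ) : ∃ u : ℂ, ‖u‖ = 1 ∧ z = ‖z‖ * u := by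
  by_cases hz : z = 0
  · exact ⟨1, by simp, by simp [hz]⟩
  · have : (‖z‖ : ℂ) ≠ 0 := by simpa using hz
    exact ⟨z / ‖z‖, by simp [hz], by field_simp⟩

/-- Absorbing the phase of `z` into `C` leaves a real part, which two of the four polarization terms
suffice to express. Both are values of positive functionals when `Y` is positive. -/
theorem re_mul_ensemble (B C : K →L[ℂ] K) {z u : ℂ} (hz : z = ‖z‖ * u)
    {Y : K →L[ℂ] K} (hY : star Y = Y) :
    (z * ensemble v hv (star B * Y * C)).re
      = ‖z‖ / 4 * ((ensemble v hv (star (B + u • C) * Y * (B + u • C))).re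
        - (ensemble v hv (star (B - u • C) * Y * (B - u • C))).re) := by
  have h : ensemble v hv (star C * Y * B) = conj (ensemble v hv (star B * Y * C)) := by
    rw [← ensemble_star]
    congr 1
    simp [hY, mul_assoc]
  have e : ensemble v hv (star (B + u • C) * Y * (B + u • C))
      - ensemble v hv (star (B - u • C) * Y * (B - u • C))
      = 2 * (u * ensemble v hv (star B * Y * C) + conj (u * ensemble v hv (star B * Y * C))) := by
    rw [map_mul (starRingEnd ℂ), ← h]
    simp only [star_add, star_sub, star_smul, add_mul, mul_add, sub_mul, mul_sub, map_add, map_sub,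
      smul_mul_assoc, mul_smul_comm, map_smul, smul_eq_mul, RCLike.star_def]
    ring
  have e2 := congrArg Complex.re e
  rw [Complex.sub_re, Complex.add_conj, ← Complex.ofReal_ofNat, ← Complex.ofReal_mul,
    Complex.ofReal_re] at e2
  rw [e2]
  conv_lhs => rw [hz, mul_assoc, Complex.re_ofReal_mul]
  ring

/-- With `Y = 1` this adds up the masses of the two functionals of `re_mul_ensemble`, independently
of the phase. -/
theorem ensemble_parallelogram (B C Y : K →L[ℂ] K) {u : ℂ} (hu : ‖u‖ = 1) :
    (ensemble v hv (star (B + u • C) * Y * (B + u • C))).re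
      + (ensemble v hv (star (B - u • C) * Y * (B - u • C))).re
      = 2 * ((ensemble v hv (star B * Y * B)).re + (ensemble v hv (star C * Y * C)).re) := by
  have huu : conj u * u = 1 := by rw [Complex.conj_mul', hu]; simp
  have e : ensemble v hv (star (B + u • C) * Y * (B + u • C))
      + ensemble v hv (star (B - u • C) * Y * (B - u • C))
      = ((2 : ℝ) : ℂ) * (ensemble v hv (star B * Y * B) + ensemble v hv (star C * Y * C)) := by
    simp only [star_add, star_sub, star_smul, add_mul, mul_add, sub_mul, mul_sub, map_add, map_sub,
      smul_mul_assoc, mul_smul_comm, map_smul, smul_eq_mul, RCLike.star_def]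
    push_cast
    linear_combination (2 * ensemble v hv (star C * Y * C)) * huu
  rw [← Complex.add_re, e, Complex.re_ofReal_mul, Complex.add_re]

end Ensemble

/-! ### Simulating diagonal and off-diagonal terms -/

section Dimension

variable {N : ℕ} {H : Fin N → Type u} [∀ n, NormedAddCommGroup (H n)]
  [∀ n, InnerProductSpace ℂ (H n)] [∀ n, CompleteSpace (H n)]

omit [∀ n, CompleteSpace (H n)] in
theorem prod_update_functional (m : Fin N) (σ : ∀ n, (H n →L[ℂ] H n) → ℝ)
    (τ : (H m →L[ℂ] H m) → ℝ) (X : ∀ n, H n →L[ℂ] H n) :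
    ∏ n, (Function.update σ m τ) n (X n) = τ (X m) * ∏ n ∈ Finset.univ.erase m, σ n (X n) := by
  rw [← Finset.mul_prod_erase _ _ (Finset.mem_univ m), Function.update_self]
  congr 1
  exact Finset.prod_congr rfl fun n hn => by rw [Function.update_of_ne (Finset.ne_of_mem_erase hn)]

variable {S : Fin N → ℕ} {Λ : Fin N → Type w} [∀ n, MeasurableSpace (Λ n)]
  {κ : Type*} (v : κ → HilbertTensor H) (hv : Summable fun k => ‖v k‖ ^ 2)

omit [∀ n, CompleteSpace (H n)] in
/-- The embedding `A ↦ 1 ⊗ ⋯ ⊗ A ⊗ ⋯ ⊗ 1` at the site `m`. -/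
def siteOp (m : Fin N) (A : H m →L[ℂ] H m) : HilbertTensor H →L[ℂ] HilbertTensor H :=
  tensorOp (Function.update (fun _ => 1) m A)

omit [∀ n, CompleteSpace (H n)] in
theorem siteOp_one (m : Fin N) : siteOp m (1 : H m →L[ℂ] H m) = 1 := by
  rw [siteOp, ← tensorOp_one]
  congr 1
  funext n
  by_cases h : n = m
  · subst h; simp
  · simp [h]

theorem isPositive_siteOp (m : Fin N) {A : H m →L[ℂ] H m} (hA : A.IsPositive) :
    (siteOp m A).IsPositive := by
  refine isPositive_tensorOp fun n => ?_
  by_cases h : n = m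
  · subst h; simpa using hA
  · simp [h]

/-- The normal positive functional `A ↦ ∑ₖ ⟪B vₖ, (1 ⊗ A) B vₖ⟫` at the site `m`. -/
def siteFunctional (m : Fin N) (B : HilbertTensor H →L[ℂ] HilbertTensor H) (A : H m →L[ℂ] H m) :
    ℝ := (ensemble v hv (star B * siteOp m A * B)).re

theorem isNormal_siteFunctional (m : Fin N) (B : HilbertTensor H →L[ℂ] HilbertTensor H) :
    IsNormal (siteFunctional v hv m B) := by
  have h := isNormal_ensemble (H := H) (fun k => B (v k)) (summable_norm_sq_apply hv B)
    (X := fun _ => 1) m (fun _ _ => ContinuousLinearMap.isPositive_one)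
  have e : siteFunctional v hv m B = fun A => (ensemble (fun k => B (v k))
      (summable_norm_sq_apply hv B) (tensorOp (Function.update (fun _ => 1) m A))).re := by
    funext A
    rw [siteFunctional, ensemble_star_mul_mul, siteOp]
  rw [e]
  exact h

omit [∀ n, CompleteSpace (H n)] in
theorem siteFunctional_one (m : Fin N) (B : HilbertTensor H →L[ℂ] HilbertTensor H) :
    siteFunctional v hv m B 1 = (ensemble v hv (star B * B)).re := by
  rw [siteFunctional, siteOp_one, mul_one]

/-- Products of expectation values at all sites but `m` and a normal positive functional at `m`. -/
theorem isSimulated_prod_erase (M : ∀ n, Fin (S n) → POVM (Λ n) (H n)) (m : Fin N) (η : ∀ n, H n)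
    (hη : ∀ n, n ≠ m → ‖η n‖ = 1) (B : HilbertTensor H →L[ℂ] HilbertTensor H) :
    IsSimulated (fun s (F : ∀ n, Set (Λ n)) => siteFunctional v hv m B ((M m (s m)).op (F m)) *
      ∏ n ∈ Finset.univ.erase m, (⟪η n, (M n (s n)).op (F n) (η n)⟫_ℂ).re)
      ((ensemble v hv (star B * B)).re) := by
  set σ : ∀ n, (H n →L[ℂ] H n) → ℝ := fun n A => (⟪η n, A (η n)⟫_ℂ).re with hσ
  have hn : ∀ n, IsNormal (Function.update σ m (siteFunctional v hv m B) n) := fun n => by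
    by_cases h : n = m
    · subst h; simpa using isNormal_siteFunctional v hv _ B
    · rw [Function.update_of_ne h]; exact isNormal_inner (η n)
  refine (isSimulated_prod M hn).congr (fun s F _ => ?_) (le_of_eq ?_)
  · exact (prod_update_functional m σ (siteFunctional v hv m B)
      fun n => (M n (s n)).op (F n)).symm
  · rw [prod_update_functional m σ (siteFunctional v hv m B) fun _ => 1, siteFunctional_one,
      Finset.prod_eq_one, mul_one]
    intro n hn
    simp [hσ, hη n (Finset.ne_of_mem_erase hn)]

theorem inner_eq_re_of_isPositive {E : Type u} [NormedAddCommGroup E] [InnerProductSpace ℂ E]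
    {A : E →L[ℂ] E} (hA : A.IsPositive) (x : E) : ⟪x, A x⟫_ℂ = ((⟪x, A x⟫_ℂ).re : ℂ) :=
  (Complex.ext rfl (by simpa using ((Complex.le_def.1 (hA.inner_nonneg_right x)).2.symm)))

/-- A product of matrix elements at all sites but `m`, times a matrix element of the ensemble, is
simulated at cost `2 ^ (N - 2)` times the weights of the two vectors. -/
theorem isSimulated_offDiag (M : ∀ n, Fin (S n) → POVM (Λ n) (H n)) (m : Fin N)
    (x : ∀ n, (H n →L[ℂ] H n) → ℂ)
    (hx : ∀ n, n ≠ m → ∃ (κ : Fin 4 → ℂ) (η : Fin 4 → H n), ∑ k, ‖κ k‖ ≤ 2 ∧ (∀ k, ‖η k‖ = 1) ∧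
      ∀ X, x n X = ∑ k, κ k * ⟪η k, X (η k)⟫_ℂ)
    (B C : HilbertTensor H →L[ℂ] HilbertTensor H) :
    IsSimulated (fun s (F : ∀ n, Set (Λ n)) =>
        ((∏ n ∈ Finset.univ.erase m, x n ((M n (s n)).op (F n))) *
          ensemble v hv (star B * siteOp m ((M m (s m)).op (F m)) * C)).re)
      (2 ^ (N - 1) / 2 * ((ensemble v hv (star B * B)).re + (ensemble v hv (star C * C)).re)) := by
  have hx' : ∀ n, ∃ (κ : Fin 4 → ℂ) (η : Fin 4 → H n), ∑ k, ‖κ k‖ ≤ (if n = m then 1 else 2) ∧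
      (n = m → ∑ k, κ k = 1) ∧ (n ≠ m → (∀ k, ‖η k‖ = 1) ∧
      ∀ X, x n X = ∑ k, κ k * ⟪η k, X (η k)⟫_ℂ) := fun n => by
    by_cases h : n = m
    · refine ⟨Pi.single 0 1, fun _ => 0, ?_, fun _ => ?_, fun h' => absurd h h'⟩
      · simp [h, Fin.sum_univ_four, Pi.single_apply]
      · simp
    · obtain ⟨κ, η, h1, h2, h3⟩ := hx n h
      exact ⟨κ, η, by simpa [h] using h1, fun h' => absurd h' h, fun _ => ⟨h2, h3⟩⟩
  choose κ η h1 h2 h3 using hx'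
  set z : (Fin N → Fin 4) → ℂ := fun ω => ∏ n, κ n (ω n) with hz
  choose u hu hzu using fun ω => exists_phase (z ω)
  set r : ℝ := (ensemble v hv (star B * B)).re + (ensemble v hv (star C * C)).re with hr
  have hr0 : 0 ≤ r := by
    have := ensemble_re_nonneg v hv (ContinuousLinearMap.isPositive_adjoint_comp_self B)
    have := ensemble_re_nonneg v hv (ContinuousLinearMap.isPositive_adjoint_comp_self C)
    exact add_nonneg ‹_› ‹_›
  -- One product measure for each choice of polarization vectors at the sites `n ≠ m` and each sign
  -- in `B ± u C`.
  have hsim : ∀ p : (Fin N → Fin 4) × Bool, IsSimulated (fun s (F : ∀ n, Set (Λ n)) =>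
      siteFunctional v hv m (if p.2 then B + u p.1 • C else B - u p.1 • C)
        ((M m (s m)).op (F m)) *
      ∏ n ∈ Finset.univ.erase m, (⟪η n (p.1 n), (M n (s n)).op (F n) (η n (p.1 n))⟫_ℂ).re)
      ((ensemble v hv (star (if p.2 then B + u p.1 • C else B - u p.1 • C) *
        (if p.2 then B + u p.1 • C else B - u p.1 • C))).re) := fun p =>
    isSimulated_prod_erase v hv M m (fun n => η n (p.1 n)) (fun n hn => (h3 n hn).1 _) _
  refine (IsSimulated.sum (fun p : (Fin N → Fin 4) × Bool =>
    (if p.2 then 1 else -1) * (‖z p.1‖ / 4)) hsim).congr (fun s F hF => ?_) ?_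
  · have hpos : ∀ n, ((M n (s n)).op (F n)).IsPositive := fun n => (M n (s n)).isPositive _ (hF n)
    have hprod : ∏ n ∈ Finset.univ.erase m, x n ((M n (s n)).op (F n))
        = ∑ ω : Fin N → Fin 4, z ω * ((∏ n ∈ Finset.univ.erase m,
          (⟪η n (ω n), (M n (s n)).op (F n) (η n (ω n))⟫_ℂ).re : ℝ) : ℂ) := by
      have e : ∀ n, (∑ k, κ n k * if n = m then 1 else
          (((⟪η n k, (M n (s n)).op (F n) (η n k)⟫_ℂ).re : ℝ) : ℂ))
          = if n = m then 1 else x n ((M n (s n)).op (F n)) := fun n => by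
        by_cases h : n = m
        · simp [h, h2 m rfl]
        · simp only [h, if_false]
          rw [(h3 n h).2]
          exact Finset.sum_congr rfl fun k _ => by rw [← inner_eq_re_of_isPositive (hpos n)]
      have e2 : ∏ n ∈ Finset.univ.erase m, x n ((M n (s n)).op (F n))
          = ∏ n, if n = m then 1 else x n ((M n (s n)).op (F n)) := by
        rw [← Finset.mul_prod_erase _ _ (Finset.mem_univ m)]
        simp only [if_true, one_mul]
        exact Finset.prod_congr rfl fun n hn => by rw [if_neg (Finset.ne_of_mem_erase hn)]
      rw [e2]
      simp only [← e]
      rw [Fintype.prod_sum]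
      refine Finset.sum_congr rfl fun ω _ => ?_
      rw [Finset.prod_mul_distrib]
      congr 1
      rw [← Finset.mul_prod_erase _ _ (Finset.mem_univ m)]
      push_cast
      simp only [if_true, one_mul]
      exact Finset.prod_congr rfl fun n hn => by rw [if_neg (Finset.ne_of_mem_erase hn)]
    rw [hprod, Finset.sum_mul, Complex.re_sum, Fintype.sum_prod_type]
    refine Finset.sum_congr rfl fun ω _ => ?_
    have hY : star (siteOp m ((M m (s m)).op (F m))) = siteOp m ((M m (s m)).op (F m)) :=
      (isPositive_siteOp m (hpos m)).isSelfAdjoint.star_eq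
    rw [mul_right_comm, mul_comm, Complex.re_ofReal_mul, re_mul_ensemble v hv B C (hzu ω) hY]
    simp only [Fintype.sum_bool, siteFunctional, if_true, Bool.false_eq_true, if_false]
    ring
  · rw [Fintype.sum_prod_type]
    have e : ∀ ω : Fin N → Fin 4, (∑ y : Bool,
        |(if ((ω, y) : (Fin N → Fin 4) × Bool).2 then (1 : ℝ) else -1) *
          (‖z ((ω, y) : (Fin N → Fin 4) × Bool).1‖ / 4)| *
        (ensemble v hv (star (if ((ω, y) : (Fin N → Fin 4) × Bool).2
          then B + u ((ω, y) : (Fin N → Fin 4) × Bool).1 • C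
          else B - u ((ω, y) : (Fin N → Fin 4) × Bool).1 • C) *
          (if ((ω, y) : (Fin N → Fin 4) × Bool).2
          then B + u ((ω, y) : (Fin N → Fin 4) × Bool).1 • C
          else B - u ((ω, y) : (Fin N → Fin 4) × Bool).1 • C))).re) = ‖z ω‖ / 2 * r := fun ω => by
      have h := ensemble_parallelogram v hv B C 1 (hu ω)
      simp only [mul_one] at h
      have ha : |‖z ω‖ / 4| = ‖z ω‖ / 4 := abs_of_nonneg (by positivity)
      simp only [Fintype.sum_bool, if_true, Bool.false_eq_true, if_false, one_mul, neg_mul, abs_neg,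
        ha]
      rw [← mul_add, h]
      ring
    simp only [e]
    rw [← Finset.sum_mul, ← Finset.sum_div]
    refine mul_le_mul_of_nonneg_right (div_le_div_of_nonneg_right ?_ (by norm_num)) hr0
    have e2 : ∑ ω, ‖z ω‖ = ∏ n, ∑ k, ‖κ n k‖ := by
      rw [Fintype.prod_sum]
      exact Finset.sum_congr rfl fun ω _ => by rw [hz, norm_prod]
    rw [e2]
    refine (Finset.prod_le_prod (fun n _ => Finset.sum_nonneg fun k _ => norm_nonneg _)
      fun n _ => h1 n).trans_eq ?_
    rw [← Finset.mul_prod_erase _ _ (Finset.mem_univ m), if_pos rfl, one_mul,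
      Finset.prod_congr rfl fun n hn => if_neg (Finset.ne_of_mem_erase hn)]
    simp

end Dimension

/-! ### Matrix units and the dimension bound -/

section Dimension

variable {N : ℕ} {H : Fin N → Type u} [∀ n, NormedAddCommGroup (H n)]
  [∀ n, InnerProductSpace ℂ (H n)] {d : Fin N → ℕ}

open InnerProductSpace in
/-- The tensor product of matrix units at all sites but `m`, and of `A` at the site `m`. -/
def unitOp (e : ∀ n, Fin (d n) → H n) (m : Fin N) (i j : ∀ n, Fin (d n)) (A : H m →L[ℂ] H m) :
    HilbertTensor H →L[ℂ] HilbertTensor H :=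
  tensorOp (Function.update (fun n => rankOne ℂ (e n (i n)) (e n (j n))) m A)

open InnerProductSpace in
theorem sum_matrixUnits {E : Type u} [NormedAddCommGroup E] [InnerProductSpace ℂ E] {α : Type*}
    [Fintype α] {e : α → E} (h : ∀ x, ∑ a, ⟪e a, x⟫_ℂ • e a = x) (X : E →L[ℂ] E) :
    ∑ q : α × α, ⟪e q.1, X (e q.2)⟫_ℂ • rankOne ℂ (e q.1) (e q.2) = X := by
  ext x
  conv_rhs => rw [← h (X x)]
  rw [Fintype.sum_prod_type, sum_apply]
  refine Finset.sum_congr rfl fun a _ => ?_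
  conv_rhs => rw [← h x, map_sum, inner_sum, Finset.sum_smul]
  rw [sum_apply]
  refine Finset.sum_congr rfl fun b _ => ?_
  rw [map_smul, inner_smul_right]
  simp [smul_smul, mul_comm]

theorem tensorOp_eq_sum_unitOp {e : ∀ n, Fin (d n) → H n} {m : Fin N} (hd : d m = 1)
    (h : ∀ n, n ≠ m → ∀ x, ∑ a, ⟪e n a, x⟫_ℂ • e n a = x) (X : ∀ n, H n →L[ℂ] H n) :
    tensorOp X = ∑ p : (∀ n, Fin (d n)) × (∀ n, Fin (d n)),
      (∏ n ∈ Finset.univ.erase m, ⟪e n (p.1 n), X n (e n (p.2 n))⟫_ℂ)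
        • unitOp e m p.1 p.2 (X m) := by
  -- Since `d m = 1`, the site `m` carries a single dummy index with coefficient `1` and operator `X
  -- m`; tuples over all sites then index exactly the matrix units away from `m`.
  set c : ∀ n, Fin (d n) × Fin (d n) → ℂ := fun n q =>
    if n = m then 1 else ⟪e n q.1, X n (e n q.2)⟫_ℂ with hc
  set G : ∀ n, Fin (d n) × Fin (d n) → H n →L[ℂ] H n := Function.update
    (fun n q => InnerProductSpace.rankOne ℂ (e n q.1) (e n q.2)) m (fun _ => X m) with hG
  have hX : X = fun n => ∑ q, c n q • G n q := by
    funext n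
    by_cases hn : n = m
    · subst hn
      simp [hc, hG, hd]
    · simp only [hc, hG, if_neg hn, Function.update_of_ne hn]
      exact (sum_matrixUnits (h n hn) (X n)).symm
  conv_lhs => rw [← tensorOpMultilinear_apply, hX, MultilinearMap.map_sum]
  refine Fintype.sum_equiv (Equiv.arrowProdEquivProdArrow _ _ _) _ _ fun r => ?_
  rw [MultilinearMap.map_smul_univ, tensorOpMultilinear_apply,
    ← Finset.mul_prod_erase _ _ (Finset.mem_univ m)]
  congr 1
  · simp only [hc, if_true, one_mul]
    exact Finset.prod_congr rfl fun n hn => if_neg (Finset.ne_of_mem_erase hn)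
  · rw [unitOp]
    congr 1
    funext n
    by_cases hn : n = m
    · subst hn; simp [hG]
    · simp [hG, hn, Equiv.arrowProdEquivProdArrow]

variable [∀ n, CompleteSpace (H n)]

theorem star_unitOp_one (e : ∀ n, Fin (d n) → H n) (m : Fin N) (i j : ∀ n, Fin (d n)) :
    star (unitOp e m i j 1) = unitOp e m j i 1 := by
  rw [unitOp, ContinuousLinearMap.star_eq_adjoint, adjoint_tensorOp, unitOp]
  congr 1
  funext n
  by_cases hn : n = m
  · subst hn
    rw [Function.update_self, Function.update_self]
    exact star_one _
  · simp [hn]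

/-- Since `|i⟩⟨o| |o⟩⟨j| = |i⟩⟨j|` for the unit vector at any reference index `o`, the matrix-unit
terms become a Gram-type form `B i* (1 ⊗ A) B j`. This makes the diagonal terms positive and the
others polarizable. -/
theorem unitOp_mul_siteOp_mul_unitOp {e : ∀ n, Fin (d n) → H n} {m : Fin N}
    (he : ∀ n, n ≠ m → Orthonormal ℂ (e n)) (o i j : ∀ n, Fin (d n)) (A : H m →L[ℂ] H m) :
    star (unitOp e m o i 1) * siteOp m A * unitOp e m o j 1 = unitOp e m i j A := by
  rw [star_unitOp_one, unitOp, unitOp, unitOp, siteOp, tensorOp_mul, tensorOp_mul]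
  congr 1
  funext n
  by_cases hn : n = m
  · subst hn; simp
  · simp only [Function.update_of_ne hn, mul_one]
    rw [ContinuousLinearMap.mul_def, InnerProductSpace.rankOne_comp_rankOne,
      inner_self_eq_norm_sq_to_K, (he n hn).1]
    simp

/-- The dimension bound: `1 + 2 ^ (N - 1) * (∏ₙ dₙ - 1)`, the product over all sites but `m`. -/
theorem isSimulated_dimension {S : Fin N → ℕ} {Λ : Fin N → Type w} [∀ n, MeasurableSpace (Λ n)]
    {κ : Type*} (v : κ → HilbertTensor H) (hv : Summable fun k => ‖v k‖ ^ 2)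
    (h1 : ensemble v hv 1 = 1) (M : ∀ n, Fin (S n) → POVM (Λ n) (H n)) {m : Fin N}
    (hd : d m = 1) (o : ∀ n, Fin (d n)) {e : ∀ n, Fin (d n) → H n}
    (he : ∀ n, n ≠ m → Orthonormal ℂ (e n))
    (hs : ∀ n, n ≠ m → ∀ x, ∑ a, ⟪e n a, x⟫_ℂ • e n a = x) :
    IsSimulated (fun s (F : ∀ n, Set (Λ n)) =>
        (ensemble v hv (tensorOp fun n => (M n (s n)).op (F n))).re)
      (1 + 2 ^ (N - 1) * ((∏ n, d n : ℕ) - 1)) := by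
  set T := ensemble v hv with hT
  set B : (∀ n, Fin (d n)) → HilbertTensor H →L[ℂ] HilbertTensor H :=
    fun i => unitOp e m o i 1 with hB
  set r : (∀ n, Fin (d n)) → ℝ := fun i => (T (star (B i) * B i)).re with hr
  have hext : ∀ i j : ∀ n, Fin (d n), (∀ n, n ≠ m → i n = j n) → i = j := fun i j h => by
    funext n
    by_cases hn : n = m
    · subst hn
      have : Subsingleton (Fin (d n)) := by rw [hd]; infer_instance
      exact Subsingleton.elim _ _
    · exact h n hn
  have hunit : ∀ i j A, star (B i) * siteOp m A * B j = unitOp e m i j A := fun i j A =>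
    unitOp_mul_siteOp_mul_unitOp he o i j A
  have hBB : ∀ i j, star (B i) * B j = unitOp e m i j 1 := fun i j => by
    rw [← hunit, siteOp_one, mul_one]
  -- The operators `B i* B i` are the projections onto the basis tensors away from `m`, and they sum
  -- to the identity.
  have hsum : ∑ i, r i = 1 := by
    have h2 := tensorOp_eq_sum_unitOp hd hs (fun _ => 1)
    have h3 : ∀ p : (∀ n, Fin (d n)) × (∀ n, Fin (d n)),
        (∏ n ∈ Finset.univ.erase m, ⟪e n (p.1 n), (1 : H n →L[ℂ] H n) (e n (p.2 n))⟫_ℂ)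
          = if p.1 = p.2 then 1 else 0 := fun p => by
      by_cases hp : p.1 = p.2
      · rw [if_pos hp, Finset.prod_eq_one]
        intro n hn
        rw [hp, one_apply_eq_self, inner_self_eq_norm_sq_to_K,
          (he n (Finset.ne_of_mem_erase hn)).1]
        simp
      · rw [if_neg hp]
        have : ∃ n, n ≠ m ∧ p.1 n ≠ p.2 n := by
          by_contra! h
          exact hp (hext _ _ h)
        obtain ⟨n, hn, hne⟩ := this
        refine Finset.prod_eq_zero (Finset.mem_erase.2 ⟨hn, Finset.mem_univ n⟩) ?_
        exact (he n hn).2 hne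
    rw [tensorOp_one, Finset.sum_congr rfl fun p _ => by rw [h3 p], Fintype.sum_prod_type] at h2
    simp only [ite_smul, one_smul, zero_smul, Finset.sum_ite_eq, Finset.mem_univ, if_true] at h2
    have h4 := congrArg (fun A => (T A).re) h2
    simp only [map_sum, Complex.re_sum] at h4
    rw [h1, Complex.one_re] at h4
    rw [h4]
    exact Finset.sum_congr rfl fun i _ => by rw [hr]; simp only [hBB]
  have hφ : ∀ p : (∀ n, Fin (d n)) × (∀ n, Fin (d n)),
      IsSimulated (fun s (F : ∀ n, Set (Λ n)) =>
        ((∏ n ∈ Finset.univ.erase m, ⟪e n (p.1 n), (M n (s n)).op (F n) (e n (p.2 n))⟫_ℂ) *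
          T (star (B p.1) * siteOp m ((M m (s m)).op (F m)) * B p.2)).re)
        (if p.1 = p.2 then r p.1 else 2 ^ (N - 1) / 2 * (r p.1 + r p.2)) := fun p => by
    by_cases hp : p.1 = p.2
    · refine (isSimulated_prod_erase v hv M m (fun n => e n (p.1 n))
        (fun n hn => (he n hn).1 _) (B p.1)).congr (fun s F hF => ?_) (by rw [if_pos hp])
      rw [← hp, Finset.prod_congr rfl fun n _ =>
        inner_eq_re_of_isPositive ((M n (s n)).isPositive _ (hF n)) (e n (p.1 n)),
        ← Complex.ofReal_prod, Complex.re_ofReal_mul, mul_comm]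
      rfl
    · rw [if_neg hp]
      exact isSimulated_offDiag v hv M m (fun n A => ⟪e n (p.1 n), A (e n (p.2 n))⟫_ℂ)
        (fun n hn => exists_polarization (he n hn) _ _) (B p.1) (B p.2)
  refine (IsSimulated.sum (fun _ => 1) hφ).congr (fun s F hF => ?_) (le_of_eq ?_)
  · rw [tensorOp_eq_sum_unitOp hd hs, map_sum, Complex.re_sum]
    refine Finset.sum_congr rfl fun p _ => ?_
    rw [one_mul, hunit, map_smul, smul_eq_mul]
  -- The off-diagonal cost is charged to all `D²` pairs, giving `2 ^ (N - 1) * D`, and the diagonal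
  -- is corrected by `(1 - 2 ^ (N - 1)) * r i`.
  · have e1 : ∀ i j, (if i = j then r i else 2 ^ (N - 1) / 2 * (r i + r j))
        = 2 ^ (N - 1) / 2 * (r i + r j) + if i = j then (1 - 2 ^ (N - 1)) * r i else 0 :=
      fun i j => by
        split_ifs with h
        · rw [h]; ring
        · ring
    simp only [abs_one, one_mul]
    rw [Fintype.sum_prod_type]
    simp only [e1, Finset.sum_add_distrib, Finset.sum_ite_eq, Finset.mem_univ, if_true,
      ← Finset.mul_sum, hsum, Finset.sum_const, Finset.card_univ, Fintype.card_pi, Fintype.card_fin,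
      nsmul_eq_mul]
    push_cast
    ring

end Dimension

/-! ### Local models when all sites but one have a single measurement -/

section FiniteAdditivity

variable {Λ : Type w} [MeasurableSpace Λ] {E : Type u} [NormedAddCommGroup E]
  [InnerProductSpace ℂ E]

theorem POVM.op_union (M : POVM Λ E) {F G : Set Λ} (hF : MeasurableSet F) (hG : MeasurableSet G)
    (h : Disjoint F G) : M.op (F ∪ G) = M.op F + M.op G := by
  refine ContinuousLinearMap.ext fun y => ext_inner_left ℂ fun x => ?_
  -- Finite additivity is extracted from countable additivity by padding with empty sets.
  set A : ℕ → Set Λ := fun i => if i = 0 then F else if i = 1 then G else ∅ with hA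
  have hm : ∀ i, MeasurableSet (A i) := fun i => by
    simp only [hA]; split_ifs <;> simp [hF, hG]
  have hd : Pairwise (Function.onFun Disjoint A) := fun i j hij => by
    simp only [Function.onFun, hA]
    split_ifs <;> first | omega | exact h | exact h.symm | simp
  have hU : ⋃ i, A i = F ∪ G := by
    ext z
    simp only [Set.mem_iUnion, hA, Set.mem_union]
    constructor
    · rintro ⟨i, hi⟩
      split_ifs at hi
      · exact Or.inl hi
      · exact Or.inr hi
      · exact absurd hi (Set.notMem_empty z)
    · rintro (hz | hz)
      · exact ⟨0, by simpa using hz⟩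
      · exact ⟨1, by simpa using hz⟩
  have h1 := M.hasSum_iUnion A hm hd x y
  have h2 : HasSum (fun i => ⟪x, M.op (A i) y⟫_ℂ) (∑ i ∈ Finset.range 2, ⟪x, M.op (A i) y⟫_ℂ) :=
    hasSum_sum_of_ne_finset_zero fun i hi => by
      have h0 : A i = ∅ := by
        rw [Finset.mem_range] at hi
        simp only [hA]
        rw [if_neg (by omega), if_neg (by omega)]
      simp [h0, M.op_empty]
  rw [hU] at h1
  rw [h1.unique h2, Finset.sum_range_succ, Finset.sum_range_one, add_apply, inner_add_right]
  simp [hA]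

theorem POVM.op_preimage {I : Type*} [MeasurableSpace I] [MeasurableSingletonClass I]
    (M : POVM Λ E) {f : Λ → I} (hf : Measurable f) (J : Finset I) :
    M.op (f ⁻¹' J) = ∑ a ∈ J, M.op (f ⁻¹' {a}) := by
  classical
  induction J using Finset.induction_on with
  | empty => simp [M.op_empty]
  | insert a J ha ih =>
    rw [Finset.sum_insert ha, ← ih, Finset.coe_insert, Set.insert_eq, Set.preimage_union,
      M.op_union (hf (measurableSet_singleton a)) (hf J.measurableSet)]
    exact Disjoint.preimage f (by simpa using ha)

/-- The image of a measurement under a measurable relabelling of its outcomes. -/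
def POVM.map {Λ' : Type*} [MeasurableSpace Λ'] (M : POVM Λ E) {f : Λ → Λ'} (hf : Measurable f) :
    POVM Λ' E where
  op G := M.op (f ⁻¹' G)
  isPositive G hG := M.isPositive _ (hf hG)
  op_univ := by rw [Set.preimage_univ, M.op_univ]
  hasSum_iUnion G hG hd x y := by
    rw [Set.preimage_iUnion]
    exact M.hasSum_iUnion _ (fun i => hf (hG i)) (fun i j hij => (hd hij).preimage f) x y

end FiniteAdditivity

/-! ### Finite words in the Cantor space -/

section Cantor

/-- Restriction of a binary sequence to its first `k` entries. -/
def truncate (k : ℕ) (x : ℕ → Bool) : Fin k → Bool := fun i => x i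

/-- Extension of a finite binary word by `false`. -/
def extendWord {k : ℕ} (a : Fin k → Bool) : ℕ → Bool := fun i =>
  if h : i < k then a ⟨i, h⟩ else false

theorem truncate_extendWord {k : ℕ} (a : Fin k → Bool) : truncate k (extendWord a) = a := by
  funext i
  simp [truncate, extendWord]

theorem continuous_truncate (k : ℕ) : Continuous (truncate k) := by
  unfold truncate
  fun_prop

theorem measurable_truncate (k : ℕ) : Measurable (truncate k) := by
  unfold truncate
  fun_prop

/-- The sets of binary sequences that are determined by the first `k` entries. -/
def wordSets (k : ℕ) : Set (Set (ℕ → Bool)) := {F | ∃ J : Set (Fin k → Bool), F = truncate k ⁻¹' J}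

theorem wordSets_mono {k l : ℕ} (h : k ≤ l) : wordSets k ⊆ wordSets l := by
  rintro _ ⟨J, rfl⟩
  refine ⟨(fun a i => a (Fin.castLE h i)) ⁻¹' J, ?_⟩
  rfl

theorem isClopen_of_mem_wordSets {k : ℕ} {F : Set (ℕ → Bool)} (hF : F ∈ wordSets k) :
    IsClopen F := by
  obtain ⟨J, rfl⟩ := hF
  exact (isClopen_discrete J).preimage (continuous_truncate k)

/-- Membership depends only on the first `k` digits, so it can be tested on one representative per
word. This lets Dirac masses at `extendWord a` stand for the cells of the discretization. -/
theorem mem_iff_extendWord_mem {k : ℕ} {F : Set (ℕ → Bool)} (hF : F ∈ wordSets k) :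
    F = truncate k ⁻¹' {a | extendWord a ∈ F} := by
  obtain ⟨J, rfl⟩ := hF
  ext x
  simp [truncate_extendWord]

theorem isPiSystem_wordSets : IsPiSystem (⋃ k, wordSets k) := by
  intro F hF G hG _
  obtain ⟨k, hk⟩ := Set.mem_iUnion.1 hF
  obtain ⟨l, hl⟩ := Set.mem_iUnion.1 hG
  obtain ⟨J, rfl⟩ := wordSets_mono (le_max_left k l) hk
  obtain ⟨J', rfl⟩ := wordSets_mono (le_max_right k l) hl
  exact Set.mem_iUnion.2 ⟨max k l, J ∩ J', rfl⟩

theorem generateFrom_wordSets :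
    (MeasurableSpace.pi : MeasurableSpace (ℕ → Bool))
      = MeasurableSpace.generateFrom (⋃ k, wordSets k) := by
  refine le_antisymm ?_ (MeasurableSpace.generateFrom_le fun F hF => ?_)
  · refine iSup_le fun i => ?_
    rintro _ ⟨B, -, rfl⟩
    refine MeasurableSpace.measurableSet_generateFrom (Set.mem_iUnion.2 ⟨i + 1,
      {a | a ⟨i, by omega⟩ ∈ B}, rfl⟩)
  · obtain ⟨k, J, rfl⟩ := Set.mem_iUnion.1 hF
    exact measurable_truncate k J.toFinite.measurableSet

end Cantor

/-- A sequence of probability measures on a compact metrizable space has a limit that agrees with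
the measures of clopen sets, as far as these are eventually constant. -/
theorem exists_limit_measure {Ω : Type*} [TopologicalSpace Ω] [CompactSpace Ω] [T2Space Ω]
    [MeasurableSpace Ω] [BorelSpace Ω] [HasOuterApproxClosed Ω] (P : ℕ → Measure Ω)
    [hP : ∀ k, IsProbabilityMeasure (P k)] :
    ∃ μ : Measure Ω, IsProbabilityMeasure μ ∧ ∀ (F : Set Ω) (p : ℝ), IsClopen F →
      (∀ᶠ k in Filter.atTop, (P k).real F = p) → μ.real F = p := by
  set Q : ℕ → ProbabilityMeasure Ω := fun k => ⟨P k, hP k⟩ with hQ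
  -- Compactness of the space of probability measures gives a limit along a free ultrafilter, so no
  -- subsequence has to be extracted. Clopen sets have empty frontier, and their measures pass to
  -- the limit.
  set U : Ultrafilter ℕ := Filter.hyperfilter ℕ with hU
  obtain ⟨μ, -, hμ⟩ := isCompact_univ.ultrafilter_le_nhds (U.map Q) (by simp)
  have hlim : Filter.Tendsto Q U (nhds μ) := hμ
  refine ⟨μ, inferInstance, fun F p hF hp => ?_⟩
  have h1 := ProbabilityMeasure.tendsto_measure_of_null_frontier_of_tendsto' hlim (E := F)
    (by simp [hF.frontier_eq])
  have h2 : Filter.Tendsto (fun k => (P k).real F) U (nhds ((μ : Measure Ω).real F)) :=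
    (ENNReal.tendsto_toReal (measure_ne_top _ F)).comp h1
  have h3 : ∀ᶠ k in (U : Filter ℕ), (P k).real F = p :=
    hp.filter_mono (by rw [← Nat.cofinite_eq_atTop]; exact Filter.hyperfilter_le_cofinite)
  exact tendsto_nhds_unique (h2.congr' h3) tendsto_const_nhds

/-! ### Hidden variable models from discretization and a weak limit -/

section LocalModel

variable {N : ℕ} {H : Fin N → Type u} [∀ n, NormedAddCommGroup (H n)]
  [∀ n, InnerProductSpace ℂ (H n)] [∀ n, CompleteSpace (H n)] {S : Fin N → ℕ}
  {κ : Type*} (v : κ → HilbertTensor H) (hv : Summable fun k => ‖v k‖ ^ 2)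

theorem measureReal_pi_cylinder {Λ : Fin N → Type w} [∀ n, MeasurableSpace (Λ n)]
    (ν : ∀ n, Measure (Fin (S n) → Λ n)) [∀ n, IsFiniteMeasure (ν n)] (s : ∀ n, Fin (S n))
    (F : ∀ n, Set (Λ n)) :
    (Measure.pi ν).real {ω | ∀ n, ω n (s n) ∈ F n} = ∏ n, (ν n).real {x | x (s n) ∈ F n} := by
  have e : {ω : ∀ n, Fin (S n) → Λ n | ∀ n, ω n (s n) ∈ F n}
      = Set.univ.pi fun n => {x | x (s n) ∈ F n} := by ext; simp
  rw [e, Measure.real, Measure.pi_pi, ENNReal.toReal_prod]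
  rfl

/-- A local model for events determined by finitely many binary digits at all sites but `m`. -/
theorem exists_discreteModel (h1 : ensemble v hv 1 = 1)
    (M : ∀ n, Fin (S n) → POVM (ℕ → Bool) (H n)) (s₀ : ∀ n, Fin (S n)) {m : Fin N}
    (hM : ∀ n, n ≠ m → ∀ s, M n s = M n (s₀ n)) (k : ℕ) :
    ∃ P : Measure (∀ n, Fin (S n) → ℕ → Bool), IsProbabilityMeasure P ∧
      ∀ (s : ∀ n, Fin (S n)) (F : Fin N → Set (ℕ → Bool)), (∀ n, n ≠ m → F n ∈ wordSets k) →
        MeasurableSet (F m) → P.real {ω | ∀ n, ω n (s n) ∈ F n}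
          = (ensemble v hv (tensorOp fun n => (M n (s n)).op (F n))).re := by
  classical
  have hZ : ∀ a : Fin k → Bool, MeasurableSet (truncate k ⁻¹' {a}) := fun a =>
    measurable_truncate k (measurableSet_singleton a)
  set X : (Fin N → Fin k → Bool) → ∀ n, H n →L[ℂ] H n := fun a n =>
    (M n (s₀ n)).op (truncate k ⁻¹' {a n}) with hX
  have hσ : ∀ a, IsNormal fun A => (ensemble v hv (tensorOp (Function.update (X a) m A))).re :=
    fun a => isNormal_ensemble v hv m fun n _ => (M n (s₀ n)).isPositive _ (hZ (a n))
  choose ν₀ hfin _ hν₀ using fun a => exists_jointLaw (M m) (hσ a)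
  -- Given the words `a` seen at the other sites, those sites answer deterministically and `m`
  -- follows a joint law of all its measurements under the conditional functional. The weights of
  -- the words are carried by the masses of `ν₀ a`.
  set ν : (Fin N → Fin k → Bool) → ∀ n, Measure (Fin (S n) → ℕ → Bool) := fun a =>
    Function.update (fun n => Measure.dirac fun _ => extendWord (a n)) m (ν₀ a) with hν
  have hνfin : ∀ a n, IsFiniteMeasure (ν a n) := fun a n => by
    by_cases hn : n = m
    · subst hn; simpa [hν] using hfin a
    · simp only [hν, Function.update_of_ne hn]; infer_instance
  -- At `m` no word is recorded; a single dummy word avoids counting each configuration repeatedly.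
  set A : Fin N → Finset (Fin k → Bool) := fun n =>
    if n = m then {fun _ => false} else Finset.univ with hA
  set P := ∑ a ∈ Fintype.piFinset A, Measure.pi (ν a) with hP
  have key : ∀ (s : ∀ n, Fin (S n)) (F : Fin N → Set (ℕ → Bool)),
      (∀ n, n ≠ m → F n ∈ wordSets k) → MeasurableSet (F m) →
      P.real {ω | ∀ n, ω n (s n) ∈ F n}
        = (ensemble v hv (tensorOp fun n => (M n (s n)).op (F n))).re := by
    intro s F hF hFm
    set c : Fin N → (Fin k → Bool) → ℝ := fun n a =>
      if n = m then 1 else if extendWord a ∈ F n then 1 else 0 with hc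
    set G : ∀ n, (Fin k → Bool) → H n →L[ℂ] H n := Function.update
      (fun n a => (M n (s₀ n)).op (truncate k ⁻¹' {a})) m (fun _ => (M m (s m)).op (F m)) with hG
    have hop : (fun n => (M n (s n)).op (F n)) = fun n => ∑ a ∈ A n, (c n a : ℂ) • G n a := by
      funext n
      by_cases hn : n = m
      · subst hn
        simp [hA, hc, hG]
      · simp only [hA, hc, hG, if_neg hn, Function.update_of_ne hn]
        rw [hM n hn (s n)]
        conv_lhs => rw [mem_iff_extendWord_mem (hF n hn), ← Set.coe_toFinset {a | extendWord a ∈ F n},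
          POVM.op_preimage _ (measurable_truncate k)]
        have e : ∀ a : Fin k → Bool, (((if extendWord a ∈ F n then 1 else 0 : ℝ)) : ℂ) •
            (M n (s₀ n)).op (truncate k ⁻¹' {a})
            = if extendWord a ∈ F n then (M n (s₀ n)).op (truncate k ⁻¹' {a}) else 0 := fun a => by
          split_ifs <;> simp
        simp only [e]
        rw [← Finset.sum_filter]
        refine Finset.sum_congr ?_ fun _ _ => rfl
        ext a
        simp
    rw [hop, ← tensorOpMultilinear_apply, MultilinearMap.map_sum_finset, map_sum, Complex.re_sum, hP,
      Measure.real, Measure.finsetSum_apply, ENNReal.toReal_sum fun a _ => measure_ne_top _ _]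
    refine Finset.sum_congr rfl fun a _ => ?_
    rw [MultilinearMap.map_smul_univ, map_smul, smul_eq_mul, ← Complex.ofReal_prod,
      Complex.re_ofReal_mul, tensorOpMultilinear_apply]
    have e : (fun n => G n (a n)) = Function.update (X a) m ((M m (s m)).op (F m)) := by
      funext n
      by_cases hn : n = m
      · subst hn; simp [hG]
      · simp [hG, hX, hn]
    rw [e, ← hν₀ a (s m) (F m) hFm, ← Measure.real, measureReal_pi_cylinder,
      ← Finset.mul_prod_erase _ _ (Finset.mem_univ m), mul_comm]
    congr 1
    · rw [← Finset.mul_prod_erase _ (fun n => c n (a n)) (Finset.mem_univ m)]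
      simp only [hc, if_true, one_mul]
      refine Finset.prod_congr rfl fun n hn => ?_
      have hn' := Finset.ne_of_mem_erase hn
      have hms : MeasurableSet {x : Fin (S n) → ℕ → Bool | x (s n) ∈ F n} :=
        measurable_pi_apply (s n) (isClopen_of_mem_wordSets (hF n hn')).isOpen.measurableSet
      simp only [if_neg hn', hν, Function.update_of_ne hn']
      rw [Measure.real, Measure.dirac_apply' _ hms]
      by_cases h : extendWord (a n) ∈ F n <;> simp [Set.indicator, h]
    · simp [hν]
  refine ⟨P, ⟨?_⟩, key⟩
  have h2 := key s₀ (fun _ => Set.univ) (fun _ _ => ⟨Set.univ, rfl⟩) MeasurableSet.univ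
  have h3 : (fun n => (M n (s₀ n)).op Set.univ) = fun n => (1 : H n →L[ℂ] H n) :=
    funext fun n => (M n (s₀ n)).op_univ
  rw [h3, tensorOp_one, h1] at h2
  have hPfin : IsFiniteMeasure P := by rw [hP]; infer_instance
  have h4 : P.real Set.univ = 1 := by simpa using h2
  rwa [Measure.real, ENNReal.toReal_eq_one_iff] at h4

/-- If all sites but `m` perform a single measurement with outcomes in the Cantor space, the
scenario has a local hidden variable model. -/
theorem exists_localModel_cantor (h1 : ensemble v hv 1 = 1)
    (M : ∀ n, Fin (S n) → POVM (ℕ → Bool) (H n)) (s₀ : ∀ n, Fin (S n)) {m : Fin N}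
    (hM : ∀ n, n ≠ m → ∀ s, M n s = M n (s₀ n)) :
    ∃ μ : Measure (∀ n, Fin (S n) → ℕ → Bool), IsProbabilityMeasure μ ∧
      ∀ (s : ∀ n, Fin (S n)) (F : Fin N → Set (ℕ → Bool)), (∀ n, MeasurableSet (F n)) →
        μ.real {ω | ∀ n, ω n (s n) ∈ F n}
          = (ensemble v hv (tensorOp fun n => (M n (s n)).op (F n))).re := by
  choose P hP hPF using exists_discreteModel v hv h1 M s₀ hM
  obtain ⟨μ, hμ, hlim⟩ := exists_limit_measure P
  refine ⟨μ, hμ, fun s => ?_⟩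
  -- The limit controls only rectangles with clopen sides. `B` collects the sites whose side has
  -- been freed to an arbitrary measurable set, one site at a time.
  have key : ∀ (B : Finset (Fin N)) (F : Fin N → Set (ℕ → Bool)), (∀ n, MeasurableSet (F n)) →
      (∀ n ∉ B, F n ∈ ⋃ k, wordSets k) → μ.real {ω | ∀ n, ω n (s n) ∈ F n}
        = (ensemble v hv (tensorOp fun n => (M n (s n)).op (F n))).re := by
    intro B
    induction B using Finset.induction_on with
    | empty =>
      intro F hF hw
      choose k hk using fun n => Set.mem_iUnion.1 (hw n (Finset.notMem_empty n))
      refine hlim _ _ ?_ ?_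
      · have e : {ω : ∀ n, Fin (S n) → ℕ → Bool | ∀ n, ω n (s n) ∈ F n}
            = ⋂ n, (fun ω : ∀ n, Fin (S n) → ℕ → Bool => ω n (s n)) ⁻¹' F n := by
          ext; simp
        rw [e]
        exact isClopen_iInter_of_finite fun n =>
          (isClopen_of_mem_wordSets (hk n)).preimage (by fun_prop)
      · filter_upwards [Filter.eventually_ge_atTop (Finset.univ.sup k)] with l hl
        exact hPF l s F (fun n _ => wordSets_mono ((Finset.le_sup (Finset.mem_univ n)).trans hl)
          (hk n)) (hF m)
    | insert n B hn ih =>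
      intro F hF hw
      have hσ : IsNormal fun A => (ensemble v hv (tensorOp
          (Function.update (fun n => (M n (s n)).op (F n)) n A))).re :=
        isNormal_ensemble v hv n fun n' _ => (M n' (s n')).isPositive _ (hF n')
      have hmeasF : ∀ G, MeasurableSet G → ∀ n', MeasurableSet (Function.update F n G n') :=
        fun G hG n' => by
          by_cases h : n' = n
          · subst h; simpa using hG
          · simpa [h] using hF n'
      -- With the other sides fixed, both members of the claim are finite measures in the side at
      -- `n`; they agree on the π-system of word sets, hence everywhere.
      set α : Measure (ℕ → Bool) := (μ.restrict {ω | ∀ n', ω n' (s n') ∈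
        Function.update F n Set.univ n'}).map (fun ω => ω n (s n)) with hα
      have hαG : ∀ G, MeasurableSet G → α G = μ {ω | ∀ n', ω n' (s n') ∈
          Function.update F n G n'} := fun G hG => by
        have hm : Measurable fun ω : ∀ n, Fin (S n) → ℕ → Bool => ω n (s n) := by fun_prop
        rw [hα, Measure.map_apply hm hG, Measure.restrict_apply (hm hG)]
        congr 1
        ext ω
        simp only [Set.mem_inter_iff, Set.mem_preimage, Set.mem_ofPred_eq]
        constructor
        · rintro ⟨h1, h2⟩ n'
          by_cases h : n' = n
          · subst h; simpa using h1
          · have := h2 n'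
            rw [Function.update_of_ne h] at this ⊢
            exact this
        · intro h
          refine ⟨by simpa using h n, fun n' => ?_⟩
          by_cases h' : n' = n
          · subst h'; simp
          · have := h n'
            rw [Function.update_of_ne h'] at this ⊢
            exact this
      have hαfin : IsFiniteMeasure α := by rw [hα]; infer_instance
      have hw' : ∀ G ∈ ⋃ k, wordSets k, α G = (M n (s n)).law hσ G := fun G hG => by
        obtain ⟨k, hk⟩ := Set.mem_iUnion.1 hG
        have hGm : MeasurableSet G := (isClopen_of_mem_wordSets hk).isOpen.measurableSet
        have h2 := ih (Function.update F n G) (hmeasF G hGm) fun n' hn' => by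
          by_cases h : n' = n
          · subst h; simpa using hG
          · rw [Function.update_of_ne h]
            exact hw n' (by simp [h, hn'])
        rw [hαG G hGm, ← ENNReal.toReal_eq_toReal_iff' (measure_ne_top _ _) (measure_ne_top _ _),
          ← Measure.real, ← Measure.real, (M n (s n)).law_real hσ hGm, h2]
        congr 3
        funext n'
        by_cases h : n' = n
        · subst h; simp
        · simp [h]
      have heq : α = (M n (s n)).law hσ := ext_of_generate_finite _ generateFrom_wordSets
        isPiSystem_wordSets hw' (hw' _ (Set.mem_iUnion.2 ⟨0, Set.univ, rfl⟩))
      have h3 := (M n (s n)).law_real hσ (hF n)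
      rw [← heq, Measure.real, hαG _ (hF n), Function.update_eq_self] at h3
      rw [Measure.real, h3]
      congr 3
      rw [Function.update_eq_self]
  exact fun F hF => key Finset.univ F hF fun n hn => absurd (Finset.mem_univ n) hn

/-- If all sites but `m` perform a single measurement, the scenario has a local hidden variable
model. -/
theorem exists_localModel {Λ : Fin N → Type w} [∀ n, MeasurableSpace (Λ n)]
    [∀ n, StandardBorelSpace (Λ n)] [∀ n, Nonempty (Λ n)] (h1 : ensemble v hv 1 = 1)
    (M : ∀ n, Fin (S n) → POVM (Λ n) (H n)) (s₀ : ∀ n, Fin (S n)) {m : Fin N}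
    (hM : ∀ n, n ≠ m → ∀ s, M n s = M n (s₀ n)) :
    ∃ μ : Measure (∀ n, Fin (S n) → Λ n), IsProbabilityMeasure μ ∧
      ∀ (s : ∀ n, Fin (S n)) (F : ∀ n, Set (Λ n)), (∀ n, MeasurableSet (F n)) →
        μ.real {ω | ∀ n, ω n (s n) ∈ F n}
          = (ensemble v hv (tensorOp fun n => (M n (s n)).op (F n))).re := by
  choose f hf hinj using fun n =>
    MeasurableSpace.measurable_injection_nat_bool_of_countablySeparated (Λ n)
  -- `f` embeds the outcomes into the Cantor space, and `g` is a measurable left inverse defined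
  -- everywhere. Measurements are pushed forward by `f`, and the hidden variables are carried back
  -- by `g`.
  choose g hg hgf using fun n => ((hf n).measurableEmbedding (hinj n)).exists_measurable_extend
    measurable_id fun _ => inferInstance
  obtain ⟨μ, hμ, hrect⟩ := exists_localModel_cantor v hv h1 (fun n s => (M n s).map (hf n)) s₀
    (m := m) fun n hn s => by rw [hM n hn s]
  have hG : Measurable fun (ω : ∀ n, Fin (S n) → ℕ → Bool) n s => g n (ω n s) := by
    refine measurable_pi_lambda _ fun n => measurable_pi_lambda _ fun s => (hg n).comp ?_
    fun_prop
  refine ⟨μ.map fun ω n s => g n (ω n s), Measure.isProbabilityMeasure_map hG.aemeasurable,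
    fun s F hF => ?_⟩
  rw [map_measureReal_apply hG (measurableSet_cylinder s hF)]
  refine (hrect s (fun n => g n ⁻¹' F n) fun n => hg n (hF n)).trans ?_
  congr 3
  funext n
  change (M n (s n)).op (f n ⁻¹' (g n ⁻¹' F n)) = _
  rw [← Set.preimage_comp, hgf, Set.preimage_id]

end LocalModel

/-! ### The bound by the numbers of settings -/

section Settings

variable {N : ℕ} {H : Fin N → Type u} [∀ n, NormedAddCommGroup (H n)]
  [∀ n, InnerProductSpace ℂ (H n)] [∀ n, CompleteSpace (H n)] {S : Fin N → ℕ}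
  {κ : Type*} (v : κ → HilbertTensor H) (hv : Summable fun k => ‖v k‖ ^ 2)

/-- The settings bound: `∏ₙ (2 Sₙ - 1)`, the product over all sites but `m`. -/
theorem isSimulated_settings {Λ : Fin N → Type w} [∀ n, MeasurableSpace (Λ n)]
    [∀ n, StandardBorelSpace (Λ n)] [∀ n, Nonempty (Λ n)] (h1 : ensemble v hv 1 = 1)
    (M : ∀ n, Fin (S n) → POVM (Λ n) (H n)) (s₀ : ∀ n, Fin (S n)) (m : Fin N) :
    IsSimulated (fun s (F : ∀ n, Set (Λ n)) =>
        (ensemble v hv (tensorOp fun n => (M n (s n)).op (F n))).re)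
      (∏ n ∈ Finset.univ.erase m, (2 * (S n : ℝ) - 1)) := by
  classical
  have hloc : ∀ c : ∀ n, Option (Fin (S n)), ∃ μ : Measure (∀ n, Fin (S n) → Λ n),
      IsProbabilityMeasure μ ∧ ∀ (s : ∀ n, Fin (S n)) (F : ∀ n, Set (Λ n)),
        (∀ n, MeasurableSet (F n)) → μ.real {ω | ∀ n, ω n (s n) ∈ F n}
          = (ensemble v hv (tensorOp fun n =>
            (M n (if n = m then s n else (c n).getD (s₀ n))).op (F n))).re := fun c =>
    exists_localModel v hv h1 (fun n s => M n (if n = m then s else (c n).getD (s₀ n))) s₀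
      (m := m) fun n hn s => by simp [hn]
  choose μ hμ hrect using hloc
  obtain ⟨x₀⟩ : Nonempty (∀ n, Λ n) := inferInstance
  set fill : (∀ n, Option (Fin (S n))) → (∀ n, Fin (S n) → Λ n) → ∀ n, Fin (S n) → Λ n :=
    fun c ω n s => if n = m ∨ c n = some s then ω n s else x₀ n with hfill
  have hfm : ∀ c, Measurable (fill c) := fun c => by
    refine measurable_pi_lambda _ fun n => measurable_pi_lambda _ fun s => ?_
    simp only [hfill]
    split_ifs
    · fun_prop
    · exact measurable_const
  have hprob : ∀ c, IsProbabilityMeasure ((μ c).map (fill c)) := fun c =>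
    Measure.isProbabilityMeasure_map (hfm c).aemeasurable
  set Y : ∀ (s : ∀ n, Fin (S n)) (F : ∀ n, Set (Λ n)) (n : Fin N), Option (Fin (S n)) →
      H n →L[ℂ] H n := fun s F n c => if n = m ∨ c = some (s n) then (M n (s n)).op (F n)
        else if x₀ n ∈ F n then 1 else 0 with hY
  have hmap : ∀ c (s : ∀ n, Fin (S n)) (F : ∀ n, Set (Λ n)), (∀ n, MeasurableSet (F n)) →
      ((μ c).map (fill c)).real {ω | ∀ n, ω n (s n) ∈ F n}
        = (ensemble v hv (tensorOp fun n => Y s F n (c n))).re := fun c s F hF => by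
    -- An inactive setting answers `x₀ n` with certainty, so its event becomes everything or
    -- nothing, and the measurement operator becomes `1` or `0`.
    set F' : ∀ n, Set (Λ n) := fun n => if n = m ∨ c n = some (s n) then F n else
      if x₀ n ∈ F n then Set.univ else ∅ with hF'
    have hF'm : ∀ n, MeasurableSet (F' n) := fun n => by
      simp only [hF']
      split_ifs <;> simp [hF]
    have e : fill c ⁻¹' {ω | ∀ n, ω n (s n) ∈ F n} = {ω | ∀ n, ω n (s n) ∈ F' n} := by
      ext ω
      refine forall_congr' fun n => ?_
      simp only [hfill, hF']
      split_ifs with h1 h2 <;> simp [*]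
    rw [map_measureReal_apply (hfm c) (measurableSet_cylinder s hF), e, hrect c s F' hF'm]
    congr 3
    funext n
    simp only [hF', hY]
    by_cases hn : n = m
    · simp [hn]
    · by_cases hc : c n = some (s n)
      · simp [hc]
      · simp only [hn, hc, or_self, if_false]
        split_ifs
        · exact (M n _).op_univ
        · exact (M n _).op_empty
  -- For a given setting, the `S n` active choices yield the true operator once and the
  -- deterministic one `S n - 1` times; the coefficient at `none` cancels the latter. At `m` only
  -- the choice `none` is kept, to count that site once.
  set b : ∀ n, Option (Fin (S n)) → ℝ := fun n c =>
    if n = m then (if c = none then 1 else 0) else (if c = none then -((S n : ℝ) - 1) else 1) with hb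
  have hS : ∀ n, (1 : ℝ) ≤ S n := fun n => by exact_mod_cast (s₀ n).pos
  refine (IsSimulated.sum (fun c : ∀ n, Option (Fin (S n)) => ∏ n, b n (c n))
    fun c => IsSimulated.of_measure ((μ c).map (fill c))).congr (fun s F hF => ?_) (le_of_eq ?_)
  · have hop : (fun n => (M n (s n)).op (F n)) = fun n => ∑ c, (b n c : ℂ) • Y s F n c := by
      funext n
      rw [Fintype.sum_option]
      by_cases hn : n = m
      · simp [hb, hY, hn]
      · have e : ∀ t : Fin (S n), (b n (some t) : ℂ) • Y s F n (some t)
            = (if x₀ n ∈ F n then 1 else 0)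
              + if t = s n then (M n (s n)).op (F n) - (if x₀ n ∈ F n then 1 else 0) else 0 :=
          fun t => by
            by_cases ht : t = s n <;> simp [hb, hY, hn, ht]
        simp only [e, Finset.sum_add_distrib, Finset.sum_ite_eq', Finset.mem_univ, if_true,
          Finset.sum_const, Finset.card_univ, Fintype.card_fin]
        simp only [hb, hY, hn, if_false, if_true, false_or, reduceCtorEq]
        generalize (if x₀ n ∈ F n then 1 else 0 : H n →L[ℂ] H n) = D
        rw [← Nat.cast_smul_eq_nsmul ℂ]
        push_cast
        module
    rw [hop, ← tensorOpMultilinear_apply, MultilinearMap.map_sum, map_sum, Complex.re_sum]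
    refine Finset.sum_congr rfl fun c _ => ?_
    rw [MultilinearMap.map_smul_univ, map_smul, smul_eq_mul, ← Complex.ofReal_prod,
      Complex.re_ofReal_mul, tensorOpMultilinear_apply, hmap c s F hF]
  · have e : ∀ n, ∑ c, |b n c| = if n = m then 1 else 2 * (S n : ℝ) - 1 := fun n => by
      rw [Fintype.sum_option]
      by_cases hn : n = m
      · simp [hb, hn]
      · simp only [hb, hn, if_false, if_true, reduceCtorEq, abs_one, abs_neg,
          abs_of_nonneg (sub_nonneg.2 (hS n)), Finset.sum_const, Finset.card_univ, Fintype.card_fin,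
          nsmul_eq_mul]
        ring
    simp only [probReal_univ, mul_one, Finset.abs_prod]
    rw [← Fintype.prod_sum fun n c => |b n c|, ← Finset.mul_prod_erase _ _ (Finset.mem_univ m), e m, if_pos rfl, one_mul]
    exact Finset.prod_congr rfl fun n hn => by rw [e n, if_neg (Finset.ne_of_mem_erase hn)]

end Settings

/-! ### Violations of Bell-type inequalities -/

section Ratio

variable {N : ℕ} {H : Fin N → Type u} [∀ n, NormedAddCommGroup (H n)]
  [∀ n, InnerProductSpace ℂ (H n)] {S : Fin N → ℕ}
  {Λ : Fin N → Type w} [∀ n, MeasurableSpace (Λ n)]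

theorem abs_integral_sub_integral_le {α : Type*} [MeasurableSpace α] {μ₁ μ₂ : Measure α}
    [IsFiniteMeasure μ₁] [IsFiniteMeasure μ₂] {f : α → ℝ} {C : ℝ} (hf : ∀ x, |f x| ≤ C) :
    |∫ x, f x ∂μ₁ - ∫ x, f x ∂μ₂| ≤ C * (μ₁.real Set.univ + μ₂.real Set.univ) := by
  have h1 := norm_integral_le_of_norm_le_const (μ := μ₁) (f := f) (Filter.Eventually.of_forall hf)
  have h2 := norm_integral_le_of_norm_le_const (μ := μ₂) (f := f) (Filter.Eventually.of_forall hf)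
  rw [mul_add]
  exact (norm_sub_le _ _).trans (add_le_add h1 h2)

/-- Pulling each `ψ s` back along its marginal projection collects the quantum value into one
integral of `Ψ` against `μ`, and `|Ψ|` is at most the local hidden variable constant. -/
theorem bellRatio_le {ρ : HilbertTensor H →L[ℂ] HilbertTensor H}
    (M : ∀ n, Fin (S n) → POVM (Λ n) (H n)) {P : (∀ n, Fin (S n)) → Measure (∀ n, Λ n)}
    (hP : ∀ s, IsJointDistribution ρ M s (P s)) {ψ : (∀ n, Fin (S n)) → (∀ n, Λ n) → ℝ}
    (hψ : ∀ s, Measurable (ψ s) ∧ ∃ C, ∀ x, |ψ s x| ≤ C) (hB : lhvBound ψ ≠ 0)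
    {μ : SignedMeasure (∀ n, Fin (S n) → Λ n)} (hμ : Simulates ρ M μ) :
    ENNReal.ofReal (|∑ s, ∫ x, ψ s x ∂(P s)| / lhvBound ψ) ≤ μ.totalVariation Set.univ := by
  set μ₁ := μ.toJordanDecomposition.posPart with hμ₁
  set μ₂ := μ.toJordanDecomposition.negPart with hμ₂
  have hμv : ∀ A, MeasurableSet A → μ A = μ₁.real A - μ₂.real A := fun A hA => by
    conv_lhs => rw [← μ.toSignedMeasure_toJordanDecomposition]
    simp [JordanDecomposition.toSignedMeasure, hA, hμ₁, hμ₂]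
  choose hm C hC using hψ
  have hproj : ∀ s : ∀ n, Fin (S n), Measurable fun (ω : ∀ n, Fin (S n) → Λ n) n => ω n (s n) :=
    fun s => by fun_prop
  -- Moving the negative part to the left states the marginal condition between positive measures,
  -- so that the π-system of rectangles determines it.
  have hmarg : ∀ s, P s + μ₂.map (fun ω n => ω n (s n)) = μ₁.map fun ω n => ω n (s n) := fun s => by
    have hprob := (hP s).1
    have key : ∀ F : ∀ n, Set (Λ n), (∀ n, MeasurableSet (F n)) →
        (P s + μ₂.map fun ω n => ω n (s n)) (Set.univ.pi F)
          = (μ₁.map fun ω n => ω n (s n)) (Set.univ.pi F) := fun F hF => by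
      have hcyl : (fun (ω : ∀ n, Fin (S n) → Λ n) n => ω n (s n)) ⁻¹' Set.univ.pi F
          = {ω | ∀ n, ω n (s n) ∈ F n} := by ext; simp
      have h1 := ((hP s).2 F hF).trans (hμ.2 s F hF).symm
      rw [Complex.ofReal_inj, hμv _ (measurableSet_cylinder s hF)] at h1
      rw [Measure.add_apply, Measure.map_apply (hproj s) (MeasurableSet.univ_pi hF),
        Measure.map_apply (hproj s) (MeasurableSet.univ_pi hF), hcyl,
        ← ENNReal.toReal_eq_toReal_iff' (by finiteness) (by finiteness),
        ENNReal.toReal_add (by finiteness) (by finiteness)]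
      simp only [Measure.real] at h1
      linarith
    refine ext_of_generate_finite _ generateFrom_pi.symm isPiSystem_pi ?_ ?_
    · rintro _ ⟨F, hF, rfl⟩
      exact key F fun n => hF n (Set.mem_univ n)
    · simpa using key (fun _ => Set.univ) fun _ => MeasurableSet.univ
  have hint : ∀ s, ∫ x, ψ s x ∂(P s)
      = ∫ ω, ψ s (fun n => ω n (s n)) ∂μ₁ - ∫ ω, ψ s (fun n => ω n (s n)) ∂μ₂ := fun s => by
    have hprob := (hP s).1
    have hi : ∀ ν : Measure (∀ n, Λ n), IsFiniteMeasure ν → Integrable (ψ s) ν := fun ν _ =>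
      Integrable.of_bound (hm s).aestronglyMeasurable (C s) (Filter.Eventually.of_forall (hC s))
    have e := congrArg (fun ν => ∫ x, ψ s x ∂ν) (hmarg s)
    beta_reduce at e
    rw [integral_add_measure (hi _ inferInstance) (hi _ inferInstance),
      integral_map (hproj s).aemeasurable (hm s).aestronglyMeasurable,
      integral_map (hproj s).aemeasurable (hm s).aestronglyMeasurable] at e
    linarith
  set Ψ : (∀ n, Fin (S n) → Λ n) → ℝ := fun ω => ∑ s, ψ s fun n => ω n (s n) with hΨ
  have hsum : ∑ s, ∫ x, ψ s x ∂(P s) = ∫ ω, Ψ ω ∂μ₁ - ∫ ω, Ψ ω ∂μ₂ := by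
    have hi : ∀ ν : Measure (∀ n, Fin (S n) → Λ n), IsFiniteMeasure ν → ∀ s,
        Integrable (fun ω => ψ s fun n => ω n (s n)) ν := fun ν _ s =>
      Integrable.of_bound ((hm s).comp (hproj s)).aestronglyMeasurable (C s)
        (Filter.Eventually.of_forall fun ω => hC s _)
    rw [hΨ, integral_finsetSum _ fun s _ => hi _ inferInstance s,
      integral_finsetSum _ fun s _ => hi _ inferInstance s, ← Finset.sum_sub_distrib]
    exact Finset.sum_congr rfl fun s _ => hint s
  have hbdd : BddAbove (Set.range fun ω => |Ψ ω|) := by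
    refine ⟨∑ s, C s, ?_⟩
    rintro _ ⟨ω, rfl⟩
    exact (Finset.abs_sum_le_sum_abs _ _).trans (Finset.sum_le_sum fun s _ => hC s _)
  have hle : ∀ ω, |Ψ ω| ≤ lhvBound ψ := fun ω => le_ciSup hbdd ω
  have hpos : 0 < lhvBound ψ := lt_of_le_of_ne (Real.iSup_nonneg fun ω => abs_nonneg _) hB.symm
  have hfinal : |∑ s, ∫ x, ψ s x ∂(P s)| / lhvBound ψ ≤ μ₁.real Set.univ + μ₂.real Set.univ := by
    rw [div_le_iff₀ hpos, mul_comm, hsum]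
    exact abs_integral_sub_integral_le hle
  refine (ENNReal.ofReal_le_ofReal hfinal).trans_eq ?_
  rw [ENNReal.ofReal_add measureReal_nonneg measureReal_nonneg, Measure.real, Measure.real,
    ENNReal.ofReal_toReal (measure_ne_top _ _), ENNReal.ofReal_toReal (measure_ne_top _ _),
    SignedMeasure.totalVariation, Measure.add_apply]

theorem maxBellRatio_le_maxBellViolation (ρ : HilbertTensor H →L[ℂ] HilbertTensor H) :
    maxBellRatio.{u, w} S ρ ≤ maxBellViolation.{u, w} S ρ := by
  refine iSup_mono fun Λ => iSup_mono fun _ => iSup_mono fun _ => iSup_mono fun M => ?_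
  exact iSup_le fun P => iSup_le fun hP => iSup_le fun ψ => iSup_le fun hψ => iSup_le fun hB =>
    le_iInf₂ fun μ hμ => bellRatio_le M hP hψ hB hμ

end Ratio

/-! ### Numerical bounds -/

section Numerics

/-- Expand over subsets `J` of `I` and group by cardinality; the empty subset gives the isolated
sign. This identifies the sums in `thetaBound` with the cost in `isSimulated_settings`. -/
theorem prod_two_mul_sub_one {ι : Type*} [DecidableEq ι] (I : Finset ι) (S : ι → ℕ) :
    ∏ j ∈ I, (2 * (S j : ℤ) - 1) = (-1) ^ I.card + ∑ k ∈ Finset.range I.card,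
      (-1) ^ k * 2 ^ (I.card - k) * ∑ J ∈ I.powersetCard (I.card - k), ∏ j ∈ J, (S j : ℤ) := by
  have h : ∏ j ∈ I, (2 * (S j : ℤ) - 1) = ∑ k ∈ Finset.range (I.card + 1),
      (-1) ^ k * 2 ^ (I.card - k) * ∑ J ∈ I.powersetCard (I.card - k), ∏ j ∈ J, (S j : ℤ) := by
    simp only [sub_eq_add_neg]
    rw [Finset.prod_add, Finset.sum_powerset, ← Finset.sum_range_reflect]
    refine Finset.sum_congr rfl fun k hk => ?_
    have hk' : k ≤ I.card := by simpa [Nat.lt_succ_iff] using hk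
    rw [show I.card + 1 - 1 - k = I.card - k by omega, Finset.mul_sum]
    refine Finset.sum_congr rfl fun J hJ => ?_
    obtain ⟨hJI, hJc⟩ := Finset.mem_powersetCard.1 hJ
    rw [Finset.prod_mul_distrib, Finset.prod_const, Finset.prod_const, Finset.card_sdiff_of_subset hJI,
      hJc, Nat.sub_sub_self hk']
    ring
  rw [h, Finset.sum_range_succ]
  simp [add_comm]

theorem prod_two_mul_sub_one_le {ι : Type*} [DecidableEq ι] (I : Finset ι) {S : ι → ℕ}
    (hS : ∀ j, 1 ≤ S j) :
    ∏ j ∈ I, (2 * (S j : ℝ) - 1) ≤ 1 + 2 ^ I.card * (∏ j ∈ I, (S j : ℝ) - 1) := by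
  have hS' : ∀ j, (1 : ℝ) ≤ S j := fun j => by exact_mod_cast hS j
  induction I using Finset.induction_on with
  | empty => simp
  | insert a I ha ih =>
    rw [Finset.prod_insert ha, Finset.prod_insert ha, Finset.card_insert_of_notMem ha, pow_succ]
    have hp : (1 : ℝ) ≤ ∏ j ∈ I, (S j : ℝ) := by
      have : 1 ≤ ∏ j ∈ I, S j := Nat.one_le_iff_ne_zero.2
        (Finset.prod_ne_zero_iff.2 fun j _ => Nat.one_le_iff_ne_zero.1 (hS j))
      exact_mod_cast this
    have h2 : (1 : ℝ) ≤ 2 ^ I.card := one_le_pow₀ (by norm_num)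
    have ha1 := hS' a
    generalize ∏ j ∈ I, (S j : ℝ) = p at *
    generalize (S a : ℝ) = x at *
    generalize (2 : ℝ) ^ I.card = t at *
    have h3 := mul_le_mul_of_nonneg_left ih (by linarith : (0 : ℝ) ≤ 2 * x - 1)
    -- After `h3` the remaining gap is `(t - 1) * (2 * x + p - 3) + (p - 1)`, nonnegative because
    -- `t`, `x` and `p` are all at least `1`.
    nlinarith [mul_nonneg (sub_nonneg.2 h2) (by linarith : (0 : ℝ) ≤ 2 * x + p - 3)]

/-- The condition `1 ≤ P` makes the truncated subtraction in `ℝ≥0∞` agree with the real one. -/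
theorem ofReal_one_add_mul_sub {k P : ℕ} (hP : 1 ≤ P) :
    ENNReal.ofReal (1 + 2 ^ k * ((P : ℝ) - 1)) = 1 + 2 ^ k * ((P : ℝ≥0∞) - 1) := by
  obtain ⟨Q, rfl⟩ := Nat.exists_eq_add_of_le' hP
  push_cast
  rw [add_sub_cancel_right, ENNReal.add_sub_cancel_right ENNReal.one_ne_top,
    ENNReal.ofReal_add zero_le_one (by positivity), ENNReal.ofReal_mul (by positivity),
    ENNReal.ofReal_pow (by norm_num)]
  simp

variable {N : ℕ}

theorem thetaBound_le (S : Fin N → ℕ) (m : Fin N) :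
    thetaBound S ≤ ∏ n ∈ Finset.univ.erase m, (2 * (S n : ℤ) - 1) := by
  have hc : (Finset.univ.erase m).card = N - 1 := by simp
  rw [prod_two_mul_sub_one, hc, thetaBound]
  gcongr
  exact Finset.inf'_le (fun I : Finset (Fin N) => ∑ k ∈ Finset.range (N - 1),
    (-1) ^ k * 2 ^ (N - 1 - k) * ∑ J ∈ I.powersetCard (N - 1 - k), ∏ j ∈ J, (S j : ℤ))
    (Finset.mem_powersetCard.2 ⟨Finset.subset_univ _, hc⟩)

theorem exists_thetaBound_eq (hN : 2 ≤ N) (S : Fin N → ℕ) :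
    ∃ m, thetaBound S = ∏ n ∈ Finset.univ.erase m, (2 * (S n : ℤ) - 1) := by
  obtain ⟨I, hI, hI'⟩ := Finset.exists_mem_eq_inf' (s := Finset.univ.powersetCard (N - 1))
    (Finset.powersetCard_nonempty.2 (by simp)) fun I : Finset (Fin N) =>
      ∑ k ∈ Finset.range (N - 1), (-1) ^ k * 2 ^ (N - 1 - k) *
        ∑ J ∈ I.powersetCard (N - 1 - k), ∏ j ∈ J, (S j : ℤ)
  obtain ⟨-, hc⟩ := Finset.mem_powersetCard.1 hI
  have hc' : Iᶜ.card = 1 := by rw [Finset.card_compl, hc, Fintype.card_fin]; omega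
  obtain ⟨m, hm⟩ := Finset.card_eq_one.1 hc'
  have he : Finset.univ.erase m = I := by
    rw [← compl_compl I, hm]
    ext n
    simp
  refine ⟨m, ?_⟩
  rw [he, prod_two_mul_sub_one, hc, thetaBound, hI']

theorem exists_prodDivMax_eq (hN : 2 ≤ N) (a : Fin N → ℕ∞) :
    ∃ m, prodDivMax a = ∏ n ∈ Finset.univ.erase m, (a n : ℝ≥0∞) := by
  have : Nonempty (Fin N) := ⟨⟨0, by omega⟩⟩
  obtain ⟨m, hm⟩ := exists_eq_ciInf_of_finite
    (f := fun m : Fin N => ∏ n ∈ Finset.univ.erase m, (a n : ℝ≥0∞))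
  exact ⟨m, hm.symm⟩

theorem ofReal_thetaBound_le (hN : 2 ≤ N) {S : Fin N → ℕ} (hS : ∀ n, 1 ≤ S n) :
    ENNReal.ofReal ((thetaBound S : ℤ) : ℝ)
      ≤ 1 + 2 ^ (N - 1) * (prodDivMax (fun n => (S n : ℕ∞)) - 1) := by
  obtain ⟨m, hm⟩ := exists_prodDivMax_eq hN fun n => (S n : ℕ∞)
  have hc : (Finset.univ.erase m).card = N - 1 := by simp
  have h1 : ((thetaBound S : ℤ) : ℝ) ≤ ∏ n ∈ Finset.univ.erase m, (2 * (S n : ℝ) - 1) := by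
    exact_mod_cast thetaBound_le S m
  have h2 := prod_two_mul_sub_one_le (Finset.univ.erase m) hS
  have hP : 1 ≤ ∏ n ∈ Finset.univ.erase m, S n := Nat.one_le_iff_ne_zero.2
    (Finset.prod_ne_zero_iff.2 fun j _ => Nat.one_le_iff_ne_zero.1 (hS j))
  rw [hc] at h2
  refine (ENNReal.ofReal_le_ofReal (h1.trans h2)).trans_eq ?_
  rw [← Nat.cast_prod, ofReal_one_add_mul_sub hP, hm]
  simp

theorem min_xiBound_thetaBound_le (hN : 2 ≤ N) (d : Fin N → ℕ∞) {S : Fin N → ℕ}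
    (hS : ∀ n, 1 ≤ S n) :
    min (xiBound d) (ENNReal.ofReal ((thetaBound S : ℤ) : ℝ)) ≤
      1 + 2 ^ (N - 1) * (min (prodDivMax d) (prodDivMax fun n => (S n : ℕ∞)) - 1) := by
  rcases le_total (prodDivMax d) (prodDivMax fun n => (S n : ℕ∞)) with h | h
  · rw [min_eq_left h]
    exact min_le_left _ _
  · rw [min_eq_right h]
    exact (min_le_right _ _).trans (ofReal_thetaBound_le hN hS)

theorem prodDivMax_const (hN : 2 ≤ N) (a : ℕ∞) :
    prodDivMax (fun _ : Fin N => a) = (a : ℝ≥0∞) ^ (N - 1) := by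
  obtain ⟨m, hm⟩ := exists_prodDivMax_eq hN fun _ => a
  rw [hm]
  simp

theorem ofReal_thetaBound_const (hN : 2 ≤ N) {S₀ : ℕ} (hS : 1 ≤ S₀) :
    ENNReal.ofReal ((thetaBound (fun _ : Fin N => S₀) : ℤ) : ℝ)
      = (2 * (S₀ : ℝ≥0∞) - 1) ^ (N - 1) := by
  obtain ⟨m, hm⟩ := exists_thetaBound_eq hN fun _ : Fin N => S₀
  obtain ⟨k, rfl⟩ := Nat.exists_eq_add_of_le' hS
  have e1 : 2 * ((k + 1 : ℕ) : ℝ≥0∞) - 1 = ((2 * k + 1 : ℕ) : ℝ≥0∞) := by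
    have : 2 * ((k + 1 : ℕ) : ℝ≥0∞) = ((2 * k + 1 : ℕ) : ℝ≥0∞) + 1 := by push_cast; ring
    rw [this, ENNReal.add_sub_cancel_right ENNReal.one_ne_top]
  have e2 : ((thetaBound (fun _ : Fin N => k + 1) : ℤ) : ℝ) = ((2 * k + 1 : ℕ) : ℝ) ^ (N - 1) := by
    rw [hm]
    simp only [Finset.prod_const, Finset.card_erase_of_mem (Finset.mem_univ m), Finset.card_univ,
      Fintype.card_fin]
    push_cast
    congr 1
    ring
  rw [e1, e2, ENNReal.ofReal_pow (Nat.cast_nonneg _), ENNReal.ofReal_natCast]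

end Numerics

/-! ### Bounds on the maximal violation -/

section StateBounds

theorem finiteDimensional_of_dimension_ne_top {E : Type u} [AddCommGroup E] [Module ℂ E]
    (h : dimension E ≠ ⊤) : FiniteDimensional ℂ E := by
  rw [dimension, Cardinal.toENat_ne_top] at h
  exact Module.rank_lt_aleph0_iff.1 h

theorem dimension_eq_finrank (E : Type u) [AddCommGroup E] [Module ℂ E] [FiniteDimensional ℂ E] :
    dimension E = (Module.finrank ℂ E : ℕ∞) := by
  rw [dimension, ← Module.finrank_eq_rank, Cardinal.toENat_nat]

theorem dimension_ne_zero (E : Type u) [AddCommGroup E] [Module ℂ E] [Nontrivial E] :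
    dimension E ≠ 0 := by
  rw [dimension, Ne, Cardinal.toENat_eq_zero]
  exact rank_pos.ne'

variable {N : ℕ} {H : Fin N → Type u} [∀ n, NormedAddCommGroup (H n)]
  [∀ n, InnerProductSpace ℂ (H n)] [∀ n, CompleteSpace (H n)] {S : Fin N → ℕ}
  {ρ : HilbertTensor H →L[ℂ] HilbertTensor H}

-- A zero factor would kill the whole tensor product, so that `1 = 0` there, against trace one. This
-- excludes dimension zero and, through `nonempty_of_povm`, empty outcome spaces.
omit [∀ n, CompleteSpace (H n)] in
theorem IsState.nontrivial (hρ : IsState ρ) (n : Fin N) : Nontrivial (H n) := by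
  obtain ⟨κ, v, hv, h1, -⟩ := exists_ensemble hρ
  by_contra h
  rw [not_nontrivial_iff_subsingleton] at h
  have h0 : (1 : HilbertTensor H →L[ℂ] HilbertTensor H) = 0 := by
    rw [← tensorOp_one, ← tensorOpMultilinear_apply]
    exact MultilinearMap.map_coord_zero _ n (Subsingleton.elim _ _)
  rw [h0, map_zero] at h1
  exact zero_ne_one h1

theorem nonempty_of_povm {Λ : Type w} [MeasurableSpace Λ] {E : Type u} [NormedAddCommGroup E]
    [InnerProductSpace ℂ E] [Nontrivial E] (M : POVM Λ E) : Nonempty Λ := by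
  by_contra h
  rw [not_nonempty_iff] at h
  have h1 := M.op_univ
  rw [Set.univ_eq_empty_iff.2 h, M.op_empty] at h1
  exact zero_ne_one h1

theorem ofReal_re_ensemble {K : Type u} [NormedAddCommGroup K] [InnerProductSpace ℂ K]
    [CompleteSpace K] {κ : Type*} (v : κ → K) (hv : Summable fun k => ‖v k‖ ^ 2)
    {A : K →L[ℂ] K} (hA : A.IsPositive) : ((ensemble v hv A).re : ℂ) = ensemble v hv A := by
  rw [← Complex.conj_eq_iff_re, ← ensemble_star, hA.isSelfAdjoint.star_eq]

variable {Λ : Fin N → Type w} [∀ n, MeasurableSpace (Λ n)]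

theorem IsState.gammaParam_le_of_isSimulated (hρ : IsState ρ) (hS : ∀ n, 1 ≤ S n)
    (M : ∀ n, Fin (S n) → POVM (Λ n) (H n)) {C : ℝ}
    (h : ∀ (κ : Set (HilbertTensor H)) (v : κ → HilbertTensor H)
      (hv : Summable fun k => ‖v k‖ ^ 2), ensemble v hv 1 = 1 →
      IsSimulated (fun s (F : ∀ n, Set (Λ n)) =>
        (ensemble v hv (tensorOp fun n => (M n (s n)).op (F n))).re) C) :
    gammaParam ρ M ≤ ENNReal.ofReal C := by
  obtain ⟨κ, v, hv, h1, hT⟩ := exists_ensemble hρ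
  refine (h κ v hv h1).gammaParam_le (fun s F hF => ?_) (fun n => ⟨0, hS n⟩) ?_
  · rw [jointProb, hT, ofReal_re_ensemble]
    exact isPositive_tensorOp fun n => (M n (s n)).isPositive _ (hF n)
  · rw [jointProb, hT, ← h1, ← tensorOp_one]
    congr 2
    funext n
    exact (M n _).op_univ

theorem IsState.gammaParam_le_thetaBound [∀ n, StandardBorelSpace (Λ n)] (hN : 2 ≤ N)
    (hρ : IsState ρ) (hS : ∀ n, 1 ≤ S n) (M : ∀ n, Fin (S n) → POVM (Λ n) (H n)) :
    gammaParam ρ M ≤ ENNReal.ofReal ((thetaBound S : ℤ) : ℝ) := by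
  obtain ⟨m, hm⟩ := exists_thetaBound_eq hN S
  have hne : ∀ n, Nonempty (Λ n) := fun n =>
    have := hρ.nontrivial n
    nonempty_of_povm (M n ⟨0, hS n⟩)
  have e : ((thetaBound S : ℤ) : ℝ) = ∏ n ∈ Finset.univ.erase m, (2 * (S n : ℝ) - 1) := by
    rw [hm]; push_cast; rfl
  rw [e]
  exact hρ.gammaParam_le_of_isSimulated hS M fun κ v hv h1 =>
    isSimulated_settings v hv h1 M (fun n => ⟨0, hS n⟩) m

theorem IsState.gammaParam_le_xiBound (hN : 2 ≤ N) (hρ : IsState ρ) (hS : ∀ n, 1 ≤ S n)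
    (M : ∀ n, Fin (S n) → POVM (Λ n) (H n)) :
    gammaParam ρ M ≤ xiBound fun n => dimension (H n) := by
  have hnt := hρ.nontrivial
  obtain ⟨m, hm⟩ := exists_prodDivMax_eq hN fun n => dimension (H n)
  -- An infinite dimension away from `m` makes the bound `⊤`, since no other factor vanishes.
  -- Otherwise only `H m` may be infinite dimensional, and no basis of it is ever used.
  by_cases htop : ∃ n, n ≠ m ∧ dimension (H n) = ⊤
  · obtain ⟨n, hn, hd⟩ := htop
    have h0 : ∏ n ∈ Finset.univ.erase m, ((dimension (H n) : ℕ∞) : ℝ≥0∞) = ⊤ := by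
      rw [← Finset.mul_prod_erase _ _ (Finset.mem_erase.2 ⟨hn, Finset.mem_univ n⟩), hd,
        ENat.toENNReal_top, ENNReal.top_mul]
      refine Finset.prod_ne_zero_iff.2 fun k _ => ?_
      simpa using dimension_ne_zero (H k)
    rw [xiBound, hm, h0]
    simp [ENNReal.mul_top]
  · push Not at htop
    have hfd : ∀ n, n ≠ m → FiniteDimensional ℂ (H n) := fun n hn =>
      finiteDimensional_of_dimension_ne_top (htop n hn)
    -- The value `1` at `m` is the dummy index required by `isSimulated_dimension`, not the
    -- dimension of `H m`.
    set d : Fin N → ℕ := fun n => if n = m then 1 else Module.finrank ℂ (H n) with hd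
    have hd1 : ∀ n, 1 ≤ d n := fun n => by
      by_cases hn : n = m
      · simp [hd, hn]
      · have := hfd n hn
        simpa [hd, hn, Nat.one_le_iff_ne_zero] using Module.finrank_pos.ne'
    have hbasis : ∀ n, ∃ e : Fin (d n) → H n, n ≠ m →
        Orthonormal ℂ e ∧ ∀ x, ∑ a, ⟪e a, x⟫_ℂ • e a = x := fun n => by
      by_cases hn : n = m
      · exact ⟨fun _ => 0, fun h => absurd hn h⟩
      · have := hfd n hn
        have hdn : Module.finrank ℂ (H n) = d n := by simp [hd, hn]
        set b := (stdOrthonormalBasis ℂ (H n)).reindex (finCongr hdn)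
        exact ⟨b, fun _ => ⟨b.orthonormal, fun x => b.sum_repr' x⟩⟩
    choose e he using hbasis
    have hprod : ∏ n ∈ Finset.univ.erase m, ((dimension (H n) : ℕ∞) : ℝ≥0∞)
        = ((∏ n, d n : ℕ) : ℝ≥0∞) := by
      rw [← Finset.mul_prod_erase _ _ (Finset.mem_univ m)]
      simp only [hd, if_true, one_mul]
      push_cast
      refine Finset.prod_congr rfl fun n hn => ?_
      have hn' := Finset.ne_of_mem_erase hn
      have := hfd n hn'
      rw [if_neg hn', dimension_eq_finrank]
      simp
    rw [xiBound, hm, hprod, ← ofReal_one_add_mul_sub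
      (Nat.one_le_iff_ne_zero.2 (Finset.prod_ne_zero_iff.2 fun n _ => Nat.one_le_iff_ne_zero.1 (hd1 n)))]
    exact hρ.gammaParam_le_of_isSimulated hS M fun κ v hv h1 =>
      isSimulated_dimension v hv h1 M (m := m) (by simp [hd]) (fun n => ⟨0, hd1 n⟩)
        (fun n hn => (he n hn).1) (fun n hn => (he n hn).2)

end StateBounds

end BellViolation

end

/-! ### Assembly of the bounds -/

theorem theorem4 {N : ℕ} (hN : 2 ≤ N) (H : Fin N → Type u)
    [∀ n, NormedAddCommGroup (H n)] [∀ n, InnerProductSpace ℂ (H n)]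
    [∀ n, CompleteSpace (H n)] [∀ n, TopologicalSpace.SeparableSpace (H n)]
    (ρ : HilbertTensor H →L[ℂ] HilbertTensor H) (hρ : IsState ρ)
    (S : Fin N → ℕ) (hS : ∀ n, 1 ≤ S n) :
    maxBellRatio.{u, w} S ρ ≤ maxBellViolation.{u, w} S ρ ∧
    maxBellViolation.{u, w} S ρ ≤
      min (xiBound fun n => dimension (H n)) (ENNReal.ofReal ((thetaBound S : ℤ) : ℝ)) ∧
    min (xiBound fun n => dimension (H n)) (ENNReal.ofReal ((thetaBound S : ℤ) : ℝ)) ≤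
      1 + 2 ^ (N - 1) *
        (min (prodDivMax fun n => dimension (H n)) (prodDivMax fun n => (S n : ℕ∞)) - 1) ∧
    ∀ (d₀ : ℕ∞) (S₀ : ℕ), (∀ n, dimension (H n) = d₀) → (∀ n, S n = S₀) →
      maxBellViolation.{u, w} S ρ ≤
        min ((2 * (S₀ : ℝ≥0∞) - 1) ^ (N - 1))
          (2 ^ (N - 1) * ((d₀ : ℝ≥0∞) ^ (N - 1) - 1) + 1) ∧
      min ((2 * (S₀ : ℝ≥0∞) - 1) ^ (N - 1))
          (2 ^ (N - 1) * ((d₀ : ℝ≥0∞) ^ (N - 1) - 1) + 1) ≤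
        1 + 2 ^ (N - 1) * (min (S₀ : ℝ≥0∞) (d₀ : ℝ≥0∞) ^ (N - 1) - 1) := by
  have hviol : maxBellViolation.{u, w} S ρ ≤
      min (xiBound fun n => dimension (H n)) (ENNReal.ofReal ((thetaBound S : ℤ) : ℝ)) :=
    iSup_le fun Λ => iSup_le fun _ => iSup_le fun _ => iSup_le fun M =>
      le_min (hρ.gammaParam_le_xiBound hN hS M) (hρ.gammaParam_le_thetaBound hN hS M)
  have hmin := min_xiBound_thetaBound_le hN (fun n => dimension (H n)) hS
  refine ⟨maxBellRatio_le_maxBellViolation ρ, hviol, hmin, fun d₀ S₀ hd hS₀ => ?_⟩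
  obtain rfl : S = fun _ => S₀ := funext hS₀
  have hd' : (fun n => dimension (H n)) = fun _ => d₀ := funext hd
  have hS1 : 1 ≤ S₀ := hS ⟨0, by omega⟩
  have hpow : min ((d₀ : ℝ≥0∞) ^ (N - 1)) ((S₀ : ℝ≥0∞) ^ (N - 1))
      = min (S₀ : ℝ≥0∞) (d₀ : ℝ≥0∞) ^ (N - 1) := by
    rcases le_total (S₀ : ℝ≥0∞) (d₀ : ℝ≥0∞) with h | h
    · rw [min_eq_left h, min_eq_right (by gcongr)]
    · rw [min_eq_right h, min_eq_left (by gcongr)]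
  rw [hd', xiBound, ofReal_thetaBound_const hN hS1, prodDivMax_const hN, min_comm,
    add_comm (1 : ℝ≥0∞)] at hviol
  rw [hd', xiBound, ofReal_thetaBound_const hN hS1, prodDivMax_const hN, prodDivMax_const hN,
    ENat.toENNReal_coe, hpow, min_comm, add_comm (1 : ℝ≥0∞) (2 ^ (N - 1) * ((d₀ : ℝ≥0∞) ^ (N - 1) - 1))] at hmin
  exact ⟨hviol, hmin⟩
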